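/- **Setting.** There are $n\ge 1$ users. User $u$ holds a data set $X^{(u)}\in\bigcup_{k\ge 1}[-1,1]^k$; the data sets are i.i.d., the size $m_u$ is drawn from a known distribution $M$ on $\{1,2,\dots\}$ with $\mathbb E_{m\sim M}[m]<\infty$, and given $m_u=k$ the data set consists of $k$ independent draws from an unknown probability distribution $\mu$ on $[-1,1]$. Users speak one after the other: the message $Z^{(u)}$ is drawn from a probability kernel $Q_u(\cdot\mid X^{(u)},Z^{(1:u-1)})$. For $0<\alpha\le 22/35$ the mechanism $Q=(Q_u)_{u\le n}$ is $\alpha$-LDP if $Q_u(S\mid x,z)\le e^{\alpha}Q_u(S\mid x',z)$ for all $u$, $z$, $x$, $x'$ and measurable $S$. Let $$R_{\alpha,n,M}=\inf_{Q\ \alpha\text{-LDP},\ \hat\theta}\ \sup_{\mu}\ \mathbb E\big[(\hat\theta(Z^{(1:n)})-\theta(\mu))^2\big],\qquad \theta(\mu)=\int x\,\mu(dx),$$ where $\hat\theta$ ranges over measurable estimators with values in $[-1,1]$ and $\mu$ over all probability distributions on $[-1,1]$. **Choice of $\tilde m$.** Let $\phi(a)=\frac{868.5}{n\alpha^2}\log\frac{8(an\alpha^2\vee1)}{\log(8(an\alpha^2\vee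 1))}$ and let $\tilde m$ be the largest integer $a\ge1$ such that $a=1$ or $\mathbb P_{m\sim M}(m\ge a)^2\ge\phi(a)$. Put $L=\log\big(8(\sqrt{\tilde m n\alpha^2}\vee1)\big)$. **DAME.** Let $\tau=\sqrt{2L/\tilde m}$, $J=\lceil1/\tau\rceil$, $h=\lfloor n/2\rfloor$. Cut $[-1,1]$ into $J$ consecutive bins of width $2\tau$ (the last one ends at $1$); bin $j$ has ends $l_j,u_j$ and centre $s_j$. *Localisation:* each user $u\le h$ forms $V^{(u)}\in\{0,1\}^J$, which is $0$ if $m_u<\tilde m$ and otherwise marks the bin of the sample mean $\bar X^{(u)}$ and its neighbours; each coordinate is released unchanged with probability $e^{\alpha/6}/(1+e^{\alpha/6})$ and flipped otherwise, independently. $\hat j$ is the (smallest) index with most released votes. *Estimation:* each user $h<u\le 2h$ releases $\hat\theta^{(u)}=\Pi\big(w_u\bar X^{(u)}+(1-w_u)s_{\hat j}\big)+\frac{14\tau}{\alpha}\ell_u$, where $w_u=\sqrt{(m_u\wedge\tilde m)/\tilde m}$, $\Pi$ is the projection onto $[(l_{\hat j}-6\tau)\vee-1,\ (u_{\hat j}+6\tau)\wedge1]$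 and $\ell_u$ is standard Laplace (density $e^{-|x|}/2$). If $n$ is odd the last user is discarded. *Output:* the projection onto $[-1,1]$ of $$\frac{\sqrt{\tilde m}\,\frac1h\sum_{u=h+1}^{2h}\hat\theta^{(u)}-\sum_{i=1}^{\tilde m}(\sqrt{\tilde m}-\sqrt i)M(i)\,s_{\hat j}}{\mathbb E_{m\sim M}[\sqrt{m\wedge\tilde m}]}.$$ **Theorem.** $\tilde m$ exists, DAME is $\alpha$-LDP, its worst-case risk satisfies $$\sup_\mu\mathbb E\big[(\hat\theta_{\rm DAME}-\theta(\mu))^2\big]\le\frac{1650\,L}{n\alpha^2\,\mathbb E_{m\sim M}[\sqrt{m\wedge\tilde m}]^2}\wedge4,$$ and the minimax risk satisfies $$R_{\alpha,n,M}\le\frac{1570\,\log\big(8(\sqrt{\tilde mn\alpha^2}\vee1)\big)}{n\alpha^2\,\mathbb E_{m\sim M}[\sqrt{m\wedge\tilde m}]^2}\wedge4 .$$ -/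

import Mathlib

open MeasureTheory ProbabilityTheory

noncomputable section

namespace UserLDP

/-! ### Data, mechanisms and the minimax risk -/

/-- The sample space `[-1, 1]` of a single observation. -/
abbrev Obs : Type := Set.Icc (-1 : ℝ) 1

/-- The space `⋃ k ≥ 1, [-1, 1] ^ k` of user data sets. -/
abbrev Dataset : Type := Σ k : ℕ+, (Fin (k : ℕ) → Obs)

/-- The law of one user's data set: the size `k` is drawn from `M`, and given `k` the data set
is a sample of `k` independent draws from `μ`. -/
def dataLaw (M : PMF ℕ+) (μ : Measure Obs) : Measure Dataset :=
  Measure.sum fun k : ℕ+ =>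
    M k • (Measure.pi fun _ : Fin (k : ℕ) => μ).map (Sigma.mk k)

/-- A sequentially interactive mechanism for `n` users: the message of user `u` (numbered from
`0`) is drawn from a probability kernel that sees the data of user `u` and the messages of the
users before. -/
structure Mechanism (n : ℕ) (X Z : Type) [MeasurableSpace X] [MeasurableSpace Z] where
  /-- the local channel of user `u` -/
  channel : (u : Fin n) → Kernel (X × (Fin (u : ℕ) → Z)) Z
  markov : ∀ u, IsMarkovKernel (channel u)

namespace Mechanism

variable {n : ℕ} {X Z : Type} [MeasurableSpace X] [MeasurableSpace Z]

/-- `α`-local differential privacy of every local channel. -/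
def IsLDP (Q : Mechanism n X Z) (α : ℝ) : Prop :=
  ∀ (u : Fin n) (z : Fin (u : ℕ) → Z) (x x' : X) (S : Set Z), MeasurableSet S →
    Q.channel u (x, z) S ≤ ENNReal.ofReal (Real.exp α) * Q.channel u (x', z) S

/-- The law of the first `k` messages when the users' data are independent with law `ν`. -/
def transcriptLaw (Q : Mechanism n X Z) (ν : Measure X) :
    (k : ℕ) → k ≤ n → Measure (Fin k → Z)
  | 0, _ => Measure.dirac (fun i => i.elim0)
  | k + 1, h =>
      ((ν.prod (Q.transcriptLaw ν k (Nat.le_of_succ_le h))) ⊗ₘ Q.channel ⟨k, h⟩).map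
        (fun p => (Fin.snoc (α := fun _ => Z) p.1.2 p.2 : Fin (k + 1) → Z))

end Mechanism

/-- Worst-case mean squared error, over all probability distributions `μ` on `[-1, 1]`, of the
estimator `est` of the mean of `μ`, computed from the `n` messages. -/
def worstCaseRisk {n : ℕ} {Z : Type} [MeasurableSpace Z] (M : PMF ℕ+)
    (Q : Mechanism n Dataset Z) (est : (Fin n → Z) → Obs) : ENNReal :=
  ⨆ μ : ProbabilityMeasure Obs,
    ∫⁻ z, ENNReal.ofReal (((est z : ℝ) - ∫ x : Obs, (x : ℝ) ∂(μ : Measure Obs)) ^ 2)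
      ∂(Q.transcriptLaw (dataLaw M (μ : Measure Obs)) n le_rfl)

/-- The minimax risk `R_{α, n, M}`: infimum over all message spaces, all `α`-LDP mechanisms and
all measurable `[-1, 1]`-valued estimators of the worst-case risk. -/
def minimaxRisk (α : ℝ) (n : ℕ) (M : PMF ℕ+) : ENNReal :=
  ⨅ (Z : Type) (_ : MeasurableSpace Z) (Q : Mechanism n Dataset Z) (_ : Q.IsLDP α)
    (est : (Fin n → Z) → Obs) (_ : Measurable est), worstCaseRisk M Q est

/-! ### The data set size distribution and the effective maximum data set size -/

/-- `P(m ≥ a)` for `m ∼ M`. -/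
def tailProb (M : PMF ℕ+) (a : ℕ+) : ℝ := ∑' k : ℕ+, if a ≤ k then (M k).toReal else 0

/-- `E[√(m ∧ a)]` for `m ∼ M`. -/
def sqrtMean (M : PMF ℕ+) (a : ℕ+) : ℝ := ∑' k : ℕ+, (M k).toReal * √((min k a : ℕ+) : ℝ)

/-- `φ(a) = 868.5 / (n α²) * log (8 (a n α² ∨ 1) / log (8 (a n α² ∨ 1)))`. -/
def phi (n : ℕ) (α : ℝ) (a : ℕ+) : ℝ :=
  868.5 / (n * α ^ 2) *
    Real.log (8 * max (a * (n * α ^ 2)) 1 / Real.log (8 * max (a * (n * α ^ 2)) 1))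

/-- `log (8 (√(a n α²) ∨ 1))`. -/
def logTerm (n : ℕ) (α : ℝ) (a : ℕ+) : ℝ := Real.log (8 * max (√(a * (n * α ^ 2))) 1)

/-! ### The DAME algorithm

Bins and users are numbered from `0`. With `h = ⌊n / 2⌋`, users `0, …, h - 1` take part in the
localisation phase and users `h, …, 2 h - 1` in the estimation phase; if `n` is odd, the last user
is discarded (she sends a constant). -/

/-- The half-width of the bins. -/
def tau (n : ℕ) (α : ℝ) (mt : ℕ+) : ℝ := √(2 * logTerm n α mt / mt)

/-- The number `⌈1 / τ⌉` of bins. -/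
def numBins (τ : ℝ) : ℕ := ⌈1 / τ⌉₊

/-- Left end of bin `j`. -/
def binLeft (τ : ℝ) (j : ℕ) : ℝ := -1 + 2 * τ * j

/-- Right end of bin `j`. The bins have width `2 τ`, except that the last one ends at `1`. -/
def binRight (τ : ℝ) (j : ℕ) : ℝ := min (-1 + 2 * τ * (j + 1)) 1

/-- Centre of bin `j`. -/
def binCenter (τ : ℝ) (j : ℕ) : ℝ := (binLeft τ j + binRight τ j) / 2

/-- Index of the bin that contains `y ∈ [-1, 1]`; the bins are closed on the left and open on the
right, and the last one also contains `1`. -/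
def binIndex (τ y : ℝ) : ℕ := min ⌊(y + 1) / (2 * τ)⌋₊ (numBins τ - 1)

/-- The sample mean of a data set. -/
def sampleMean (x : Dataset) : ℝ := (∑ t, (x.2 t : ℝ)) / x.1

/-- The vote of a user: if the data set has at least `mt` points, vote for the bin of the sample
mean and its neighbours, else for no bin. -/
def vote (τ : ℝ) (mt : ℕ+) (x : Dataset) : Fin (numBins τ) → Bool := fun j =>
  decide ((mt : ℕ) ≤ (x.1 : ℕ) ∧ binIndex τ (sampleMean x) ≤ (j : ℕ) + 1 ∧
    (j : ℕ) ≤ binIndex τ (sampleMean x) + 1)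

/-- Randomised response on one bit with parameter `π = e^{α/6} / (1 + e^{α/6})`. -/
def flipBit (α : ℝ) (b : Bool) : Measure Bool :=
  ENNReal.ofReal (Real.exp (α / 6) / (1 + Real.exp (α / 6))) • Measure.dirac b +
    ENNReal.ofReal (1 / (1 + Real.exp (α / 6))) • Measure.dirac (!b)

/-- Coordinatewise independent randomised response. -/
def randomizedResponse (α : ℝ) {J : ℕ} (v : Fin J → Bool) : Measure (Fin J → Bool) :=
  Measure.pi fun j => flipBit α (v j)

/-- The standard Laplace distribution, with density `exp (-|x|) / 2`. -/
def laplace : Measure ℝ :=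
  volume.withDensity fun x => ENNReal.ofReal (Real.exp (-|x|) / 2)

/-- Messages: a vector of (privatised) votes, or a (privatised) real number. -/
abbrev Msg (J : ℕ) : Type := (Fin J → Bool) ⊕ ℝ

/-- The votes in a message. -/
def msgVotes {J : ℕ} (z : Msg J) : Fin J → Bool := Sum.elim id (fun _ _ => false) z

/-- The real number in a message. -/
def msgReal {J : ℕ} (z : Msg J) : ℝ := Sum.elim (fun _ => 0) id z

/-- The number of votes for each bin among the messages of users `0, …, h - 1`. -/
def tally {J k : ℕ} (h : ℕ) (z : Fin k → Msg J) (j : Fin J) : ℕ :=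
  ∑ i : Fin k, if (i : ℕ) < h ∧ msgVotes (z i) j = true then 1 else 0

/-- The smallest index of a maximal entry of `c`. -/
def argmaxIndex {J : ℕ} (c : Fin J → ℕ) : ℕ :=
  sInf {j : ℕ | ∃ hj : j < J, ∀ i, c i ≤ c ⟨j, hj⟩}

/-- The elected bin. -/
def electedBin {J k : ℕ} (h : ℕ) (z : Fin k → Msg J) : ℕ := argmaxIndex (tally h z)

/-- Shrinkage of the sample mean toward the centre of bin `j`. -/
def shrunkMean (τ : ℝ) (mt : ℕ+) (j : ℕ) (x : Dataset) : ℝ :=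
  √((min (x.1 : ℕ) mt : ℕ) : ℝ) / √(mt : ℝ) *
    (sampleMean x + (√(mt : ℝ) / √((min (x.1 : ℕ) mt : ℕ) : ℝ) - 1) * binCenter τ j)

/-- Projection onto bin `j` enlarged by `6 τ` on both sides, intersected with `[-1, 1]`. -/
def project (τ : ℝ) (j : ℕ) (y : ℝ) : ℝ :=
  max (max (binLeft τ j - 6 * τ) (-1)) (min (min (binRight τ j + 6 * τ) 1) y)

/-- What a user of the estimation phase computes before adding noise. -/
def localEstimate (τ : ℝ) (mt : ℕ+) (h : ℕ) {k : ℕ}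
    (p : Dataset × (Fin k → Msg (numBins τ))) : ℝ :=
  project τ (electedBin h p.2) (shrunkMean τ mt (electedBin h p.2) p.1)

/-! Measurability facts needed to build the channels. -/

lemma measurable_of_sigma {β : Type} [MeasurableSpace β] {f : Dataset → β}
    (hf : ∀ k : ℕ+, Measurable fun x : Fin (k : ℕ) → Obs => f ⟨k, x⟩) : Measurable f := by
  intro s hs
  exact MeasurableSpace.measurableSet_iInf.2 fun k => hf k hs

lemma measurable_size : Measurable fun x : Dataset => (x.1 : ℕ) :=
  measurable_of_sigma fun k => (measurable_const : Measurable fun _ => (k : ℕ))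

lemma measurable_sampleMean : Measurable sampleMean :=
  measurable_of_sigma fun k => by
    have h : ∀ t : Fin (k : ℕ), Measurable fun x : Fin (k : ℕ) → Obs => (x t : ℝ) := fun t =>
      measurable_subtype_coe.comp (measurable_pi_apply t)
    exact ((Finset.measurable_fun_sum Finset.univ fun t _ => h t).div_const _ :
      Measurable fun x : Fin (k : ℕ) → Obs => (∑ t, (x t : ℝ)) / ((k : ℕ) : ℝ))

lemma measurable_vote (τ : ℝ) (mt : ℕ+) : Measurable (vote τ mt) := by
  have h1 : Measurable fun x : Dataset => binIndex τ (sampleMean x) := by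
    unfold binIndex
    have := measurable_sampleMean
    fun_prop
  have h2 : Measurable fun x : Dataset => ((x.1 : ℕ), binIndex τ (sampleMean x)) :=
    measurable_size.prodMk h1
  exact (measurable_of_countable (fun (q : ℕ × ℕ) (j : Fin (numBins τ)) =>
    decide ((mt : ℕ) ≤ q.1 ∧ q.2 ≤ (j : ℕ) + 1 ∧ (j : ℕ) ≤ q.2 + 1))).comp h2

lemma measurable_msgVotes {J : ℕ} : Measurable (msgVotes (J := J)) :=
  Measurable.sumElim measurable_id measurable_const

lemma measurable_msgReal {J : ℕ} : Measurable (msgReal (J := J)) :=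
  Measurable.sumElim measurable_const measurable_id

lemma measurable_electedBin {J k : ℕ} (h : ℕ) :
    Measurable (electedBin h : (Fin k → Msg J) → ℕ) := by
  have h1 : Measurable fun (z : Fin k → Msg J) (i : Fin k) => msgVotes (z i) :=
    measurable_pi_lambda _ fun i => measurable_msgVotes.comp (measurable_pi_apply i)
  exact (measurable_of_countable (fun v : Fin k → Fin J → Bool =>
    argmaxIndex fun j => ∑ i : Fin k, if (i : ℕ) < h ∧ v i j = true then 1 else 0)).comp h1

lemma measurable_localEstimate (τ : ℝ) (mt : ℕ+) (h k : ℕ) :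
    Measurable (localEstimate τ mt h (k := k)) := by
  have h1 : Measurable fun p : Dataset × (Fin k → Msg (numBins τ)) => electedBin h p.2 :=
    (measurable_electedBin h).comp measurable_snd
  have h2 : Measurable fun p : Dataset × (Fin k → Msg (numBins τ)) => sampleMean p.1 :=
    measurable_sampleMean.comp measurable_fst
  have h3 : Measurable fun p : Dataset × (Fin k → Msg (numBins τ)) => (p.1.1 : ℕ) :=
    measurable_size.comp measurable_fst
  have h4 : Measurable fun q : (ℕ × ℕ) × ℝ => project τ q.1.1
      (√((min q.1.2 mt : ℕ) : ℝ) / √(mt : ℝ) *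
        (q.2 + (√(mt : ℝ) / √((min q.1.2 mt : ℕ) : ℝ) - 1) * binCenter τ q.1.1)) := by
    refine measurable_from_prod_countable_right fun r => ?_
    unfold project
    fun_prop
  have h5 := h4.comp ((h1.prodMk h3).prodMk h2)
  simp only [Function.comp_def] at h5
  unfold localEstimate shrunkMean
  exact h5

instance (α : ℝ) (b : Bool) : IsProbabilityMeasure (flipBit α b) := by
  refine ⟨?_⟩
  have h : 0 < 1 + Real.exp (α / 6) := by positivity
  simp only [flipBit, Measure.add_apply, Measure.smul_apply, measure_univ, smul_eq_mul, mul_one]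
  rw [← ENNReal.ofReal_add (by positivity) (by positivity), ← add_div, add_comm, div_self h.ne',
    ENNReal.ofReal_one]

instance {J : ℕ} (α : ℝ) (v : Fin J → Bool) :
    IsProbabilityMeasure (randomizedResponse α v) := by
  unfold randomizedResponse
  infer_instance

instance : IsProbabilityMeasure laplace := by
  refine ⟨?_⟩
  have hint : ∫ x : ℝ, Real.exp (-|x|) = 2 := by
    rw [integral_comp_abs (f := fun x => Real.exp (-x)), integral_exp_neg_Ioi_zero, mul_one]
  have hi : Integrable fun x : ℝ => Real.exp (-|x|) := by
    by_contra hn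
    rw [integral_undef hn] at hint
    norm_num at hint
  rw [laplace, withDensity_apply _ MeasurableSet.univ, Measure.restrict_univ,
    ← ofReal_integral_eq_lintegral_ofReal (hi.div_const 2)
      (Filter.Eventually.of_forall fun x => by positivity),
    integral_div, hint]
  norm_num

/-- Channel of the localisation phase: privatised votes. -/
def localisationChannel (α τ : ℝ) (mt : ℕ+) (k : ℕ) :
    Kernel (Dataset × (Fin k → Msg (numBins τ))) (Msg (numBins τ)) :=
  ((Kernel.ofFunOfCountable (randomizedResponse α)).comap
    (fun p : Dataset × (Fin k → Msg (numBins τ)) => vote τ mt p.1)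
    ((measurable_vote τ mt).comp measurable_fst)).map Sum.inl

/-- Channel of the estimation phase: local estimate plus `14 τ / α` times a standard Laplace
variable. -/
def estimationChannel (α τ : ℝ) (mt : ℕ+) (h k : ℕ) :
    Kernel (Dataset × (Fin k → Msg (numBins τ))) (Msg (numBins τ)) :=
  (Kernel.deterministic (localEstimate τ mt h (k := k)) (measurable_localEstimate τ mt h k) ×ₖ
    Kernel.const _ laplace).map (fun q => Sum.inr (q.1 + 14 * τ / α * q.2))

/-- Channel of a discarded user. -/
def idleChannel (J k : ℕ) : Kernel (Dataset × (Fin k → Msg J)) (Msg J) :=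
  Kernel.const _ (Measure.dirac (Sum.inr 0))

instance (α τ : ℝ) (mt : ℕ+) (k : ℕ) : IsMarkovKernel (localisationChannel α τ mt k) := by
  have : IsMarkovKernel (Kernel.ofFunOfCountable
      (randomizedResponse α : (Fin (numBins τ) → Bool) → _)) :=
    ⟨fun v => inferInstanceAs (IsProbabilityMeasure (randomizedResponse α v))⟩
  exact Kernel.IsMarkovKernel.map _ measurable_inl

instance (α τ : ℝ) (mt : ℕ+) (h k : ℕ) : IsMarkovKernel (estimationChannel α τ mt h k) :=
  Kernel.IsMarkovKernel.map _ (measurable_inr.comp (by fun_prop))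

instance (J k : ℕ) : IsMarkovKernel (idleChannel J k) := by
  unfold idleChannel
  infer_instance

/-- The DAME mechanism with effective maximum data set size `mt`. -/
def dame (n : ℕ) (α : ℝ) (mt : ℕ+) : Mechanism n Dataset (Msg (numBins (tau n α mt))) where
  channel u :=
    if (u : ℕ) < n / 2 then localisationChannel α (tau n α mt) mt u
    else if (u : ℕ) < 2 * (n / 2) then estimationChannel α (tau n α mt) mt (n / 2) u
    else idleChannel (numBins (tau n α mt)) u
  markov u := by
    split_ifs <;> infer_instance

/-- Average of the messages of the estimation phase. -/
def averageEstimate {n J : ℕ} (z : Fin n → Msg J) : ℝ :=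
  (∑ u : Fin n, if n / 2 ≤ (u : ℕ) ∧ (u : ℕ) < 2 * (n / 2) then msgReal (z u) else 0) /
    ((n / 2 : ℕ) : ℝ)

/-- The debiased estimator. -/
def debiased {n : ℕ} (τ : ℝ) (M : PMF ℕ+) (mt : ℕ+) (z : Fin n → Msg (numBins τ)) : ℝ :=
  (averageEstimate z * √(mt : ℝ) -
    ∑ i ∈ Finset.Icc 1 mt, (√(mt : ℝ) - √(i : ℝ)) * (M i).toReal *
      binCenter τ (electedBin (n / 2) z)) / sqrtMean M mt

/-- The DAME estimator, truncated to the parameter space `[-1, 1]`. -/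
def dameEstimator (n : ℕ) (α : ℝ) (M : PMF ℕ+) (mt : ℕ+)
    (z : Fin n → Msg (numBins (tau n α mt))) : Obs :=
  Set.projIcc (-1) 1 (by norm_num) (debiased (tau n α mt) M mt z)

end UserLDP

end

noncomputable section

namespace UserLDP

/-! ### Transcripts -/

lemma measurable_snoc {Z : Type} [MeasurableSpace Z] (k : ℕ) :
    Measurable fun p : (Fin k → Z) × Z => (Fin.snoc (α := fun _ => Z) p.1 p.2 : Fin (k + 1) → Z) := by
  refine measurable_pi_lambda _ fun i => ?_
  induction i using Fin.lastCases with
  | last => simpa using measurable_snd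
  | cast i =>
    simp only [Fin.snoc_castSucc]
    exact (measurable_pi_apply i).comp measurable_fst

namespace Mechanism

variable {n : ℕ} {X Z : Type} [MeasurableSpace X] [MeasurableSpace Z]

lemma isProbabilityMeasure_transcriptLaw (Q : Mechanism n X Z) (ν : Measure X)
    [IsProbabilityMeasure ν] (k : ℕ) (hk : k ≤ n) :
    IsProbabilityMeasure (Q.transcriptLaw ν k hk) := by
  induction k with
  | zero => unfold transcriptLaw; infer_instance
  | succ k ih =>
    have := ih (Nat.le_of_succ_le hk)
    have := Q.markov ⟨k, hk⟩
    unfold transcriptLaw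
    refine Measure.isProbabilityMeasure_map (Measurable.aemeasurable ?_)
    exact (measurable_snoc k).comp
      ((measurable_snd.comp measurable_fst).prodMk measurable_snd)

lemma lintegral_transcriptLaw_zero (Q : Mechanism n X Z) (ν : Measure X)
    {f : (Fin 0 → Z) → ENNReal} (hf : Measurable f) :
    ∫⁻ z, f z ∂(Q.transcriptLaw ν 0 (Nat.zero_le n)) = f (fun i => i.elim0) := by
  rw [transcriptLaw, lintegral_dirac' _ hf]

lemma lintegral_transcriptLaw_succ (Q : Mechanism n X Z) (ν : Measure X)
    [IsProbabilityMeasure ν] (k : ℕ) (hk : k + 1 ≤ n) {f : (Fin (k + 1) → Z) → ENNReal}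
    (hf : Measurable f) :
    ∫⁻ z, f z ∂(Q.transcriptLaw ν (k + 1) hk) =
      ∫⁻ z, ∫⁻ x, ∫⁻ y, f (Fin.snoc (α := fun _ => Z) z y) ∂(Q.channel ⟨k, hk⟩ (x, z)) ∂ν
        ∂(Q.transcriptLaw ν k (Nat.le_of_succ_le hk)) := by
  have := Q.isProbabilityMeasure_transcriptLaw ν k (Nat.le_of_succ_le hk)
  have := Q.markov ⟨k, hk⟩
  have hs : Measurable fun p : (X × (Fin k → Z)) × Z =>
      (Fin.snoc (α := fun _ => Z) p.1.2 p.2 : Fin (k + 1) → Z) :=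
    (measurable_snoc k).comp ((measurable_snd.comp measurable_fst).prodMk measurable_snd)
  have hfs := hf.comp hs
  simp only [Function.comp_def] at hfs
  rw [transcriptLaw, lintegral_map hf hs, Measure.lintegral_compProd hfs,
    lintegral_prod_symm' _ (Measurable.lintegral_kernel_prod_right' (κ := Q.channel ⟨k, hk⟩) hfs)]

end Mechanism

/-! ### Data sets -/

lemma measurable_sigmaMk (k : ℕ+) :
    Measurable fun x : Fin (k : ℕ) → Obs => (⟨k, x⟩ : Dataset) := fun _ hs =>
  MeasurableSpace.measurableSet_iInf.1 hs k

instance (M : PMF ℕ+) (μ : Measure Obs) [IsProbabilityMeasure μ] :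
    IsProbabilityMeasure (dataLaw M μ) := by
  refine ⟨?_⟩
  rw [dataLaw, Measure.sum_apply _ MeasurableSet.univ, ← M.tsum_coe]
  refine tsum_congr fun k => ?_
  rw [Measure.smul_apply, Measure.map_apply (measurable_sigmaMk k) MeasurableSet.univ]
  simp

lemma hasSum_integral_dataLaw (M : PMF ℕ+) (μ : Measure Obs) [IsProbabilityMeasure μ]
    {f : Dataset → ℝ} (hf : Measurable f) (B : ℝ) (hB : ∀ x, |f x| ≤ B) :
    HasSum (fun k : ℕ+ => (M k).toReal *
      ∫ x, f ⟨k, x⟩ ∂(Measure.pi fun _ : Fin (k : ℕ) => μ)) (∫ x, f x ∂(dataLaw M μ)) := by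
  have hi : Integrable f (dataLaw M μ) :=
    Integrable.of_bound hf.aestronglyMeasurable B (Filter.Eventually.of_forall hB)
  have h := hasSum_integral_measure hi
  have e : ∀ k, ∫ x, f x ∂(M k • (Measure.pi fun _ : Fin (k : ℕ) => μ).map (Sigma.mk k)) =
      (M k).toReal * ∫ x, f ⟨k, x⟩ ∂(Measure.pi fun _ : Fin (k : ℕ) => μ) := fun k => by
    rw [integral_smul_measure, integral_map (measurable_sigmaMk k).aemeasurable
      hf.aestronglyMeasurable, smul_eq_mul]
  simp only [e] at h
  exact h

lemma integral_dataLaw_le_of_hasSum (M : PMF ℕ+) (μ : Measure Obs) [IsProbabilityMeasure μ]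
    {f : Dataset → ℝ} (hf : Measurable f) (B : ℝ) (hB : ∀ x, |f x| ≤ B) {g : ℕ+ → ℝ} {C : ℝ}
    (hg : HasSum (fun k => (M k).toReal * g k) C)
    (h : ∀ k : ℕ+, ∫ x, f ⟨k, x⟩ ∂(Measure.pi fun _ : Fin (k : ℕ) => μ) ≤ g k) :
    ∫ x, f x ∂(dataLaw M μ) ≤ C :=
  hasSum_le (fun k => mul_le_mul_of_nonneg_left (h k) ENNReal.toReal_nonneg)
    (hasSum_integral_dataLaw M μ hf B hB) hg

lemma hasSum_toReal (M : PMF ℕ+) : HasSum (fun k => (M k).toReal) 1 := by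
  have h := ENNReal.hasSum_toReal (f := M) (by rw [M.tsum_coe]; exact ENNReal.one_ne_top)
  rwa [← ENNReal.tsum_toReal_eq (fun k => M.apply_ne_top k), M.tsum_coe, ENNReal.toReal_one] at h

lemma integral_dataLaw_le (M : PMF ℕ+) (μ : Measure Obs) [IsProbabilityMeasure μ]
    {f : Dataset → ℝ} (hf : Measurable f) (B : ℝ) (hB : ∀ x, |f x| ≤ B) {C : ℝ}
    (h : ∀ k : ℕ+, ∫ x, f ⟨k, x⟩ ∂(Measure.pi fun _ : Fin (k : ℕ) => μ) ≤ C) :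
    ∫ x, f x ∂(dataLaw M μ) ≤ C :=
  integral_dataLaw_le_of_hasSum M μ hf B hB (by simpa using (hasSum_toReal M).mul_right C) h

/-! ### The sample mean -/

/-- The mean of a distribution on `[-1, 1]`. -/
def mean (μ : Measure Obs) : ℝ := ∫ x : Obs, (x : ℝ) ∂μ

lemma abs_mean_le (μ : Measure Obs) [IsProbabilityMeasure μ] : |mean μ| ≤ 1 := by
  have h := norm_integral_le_of_norm_le_const (μ := μ) (f := fun x : Obs => (x : ℝ)) (C := 1)
    (Filter.Eventually.of_forall fun x => abs_le.2 x.2)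
  simpa [mean] using h

lemma abs_sampleMean_le (x : Dataset) : |sampleMean x| ≤ 1 := by
  have hk : (0 : ℝ) < x.1 := by exact_mod_cast x.1.pos
  rw [sampleMean, abs_div, abs_of_pos hk, div_le_one hk]
  calc |∑ t, (x.2 t : ℝ)| ≤ ∑ t, |(x.2 t : ℝ)| := Finset.abs_sum_le_sum_abs _ _
    _ ≤ ∑ _t : Fin (x.1 : ℕ), (1 : ℝ) := Finset.sum_le_sum fun t _ => abs_le.2 (x.2 t).2
    _ = (x.1 : ℝ) := by simp

lemma sampleMean_mk (k : ℕ+) (x : Fin (k : ℕ) → Obs) :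
    sampleMean ⟨k, x⟩ = (∑ t : Fin (k : ℕ), (x t : ℝ)) / ((k : ℕ) : ℝ) := rfl

lemma integral_sampleMean (μ : Measure Obs) [IsProbabilityMeasure μ] (k : ℕ+) :
    ∫ x, sampleMean ⟨k, x⟩ ∂(Measure.pi fun _ : Fin (k : ℕ) => μ) = mean μ := by
  have hk : ((k : ℕ) : ℝ) ≠ 0 := by exact_mod_cast k.ne_zero
  simp only [sampleMean_mk]
  rw [integral_div, integral_finsetSum]
  · have : ∀ t : Fin (k : ℕ), ∫ x : Fin (k : ℕ) → Obs, (x t : ℝ) ∂(Measure.pi fun _ => μ)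
        = mean μ := fun t => integral_comp_eval (μ := fun _ : Fin (k : ℕ) => μ) (i := t)
        (f := fun y : Obs => (y : ℝ)) measurable_subtype_coe.aestronglyMeasurable
    simp only [this, Finset.sum_const, Finset.card_univ, Fintype.card_fin, nsmul_eq_mul]
    field_simp
  · intro t _
    exact Integrable.of_bound
      (measurable_subtype_coe.comp (measurable_pi_apply t)).aestronglyMeasurable 1
      (Filter.Eventually.of_forall fun x => abs_le.2 (x t).2)

lemma integral_exp_obs_le (μ : Measure Obs) [IsProbabilityMeasure μ] (t : ℝ) :
    ∫ x : Obs, Real.exp (t * ((x : ℝ) - mean μ)) ∂μ ≤ Real.exp (t ^ 2 / 2) := by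
  have h := (hasSubgaussianMGF_of_mem_Icc (μ := μ) (X := fun x : Obs => (x : ℝ)) (a := -1) (b := 1)
    measurable_subtype_coe.aemeasurable (Filter.Eventually.of_forall fun x => x.2)).mgf_le t
  refine h.trans (le_of_eq ?_)
  congr 1
  norm_num

lemma integral_exp_sampleMean_le (μ : Measure Obs) [IsProbabilityMeasure μ] (k : ℕ+) (t : ℝ) :
    ∫ x, Real.exp (t * (sampleMean ⟨k, x⟩ - mean μ)) ∂(Measure.pi fun _ : Fin (k : ℕ) => μ)
      ≤ Real.exp (t ^ 2 / (2 * k)) := by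
  have hk : ((k : ℕ) : ℝ) ≠ 0 := by exact_mod_cast k.ne_zero
  have h1 : ∀ x : Fin (k : ℕ) → Obs, Real.exp (t * (sampleMean ⟨k, x⟩ - mean μ)) =
      ∏ i, Real.exp (t / k * ((x i : ℝ) - mean μ)) := fun x => by
    rw [← Real.exp_sum, ← Finset.mul_sum, Finset.sum_sub_distrib]
    simp only [sampleMean_mk, Finset.sum_const, Finset.card_univ, Fintype.card_fin, nsmul_eq_mul]
    congr 1
    field_simp
  simp only [h1]
  rw [integral_fintype_prod_eq_pow (fun y : Obs => Real.exp (t / k * ((y : ℝ) - mean μ)))]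
  calc _ ≤ Real.exp ((t / k) ^ 2 / 2) ^ Fintype.card (Fin (k : ℕ)) :=
        pow_le_pow_left₀ (integral_nonneg fun _ => (Real.exp_pos _).le)
          (integral_exp_obs_le μ _) _
    _ = _ := by
        rw [← Real.exp_nat_mul, Fintype.card_fin]
        congr 1
        field_simp

/-! ### DAME with a general projection margin and a general noise level -/

/-- Projection onto bin `j` enlarged by `c τ` on both sides, intersected with `[-1, 1]`. -/
def projectWith (c τ : ℝ) (j : ℕ) (y : ℝ) : ℝ :=
  max (max (binLeft τ j - c * τ) (-1)) (min (min (binRight τ j + c * τ) 1) y)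

/-- The local estimate with projection margin `c τ`. -/
def localEstimateWith (c τ : ℝ) (mt : ℕ+) (h : ℕ) {k : ℕ}
    (p : Dataset × (Fin k → Msg (numBins τ))) : ℝ :=
  projectWith c τ (electedBin h p.2) (shrunkMean τ mt (electedBin h p.2) p.1)

lemma measurable_projectWith (c τ : ℝ) (j : ℕ) : Measurable (projectWith c τ j) := by
  unfold projectWith
  fun_prop

lemma measurable_shrunkMean (τ : ℝ) (mt : ℕ+) (j : ℕ) : Measurable (shrunkMean τ mt j) := by
  have h : Measurable fun q : ℕ × ℝ =>
      √((min q.1 mt : ℕ) : ℝ) / √(mt : ℝ) *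
        (q.2 + (√(mt : ℝ) / √((min q.1 mt : ℕ) : ℝ) - 1) * binCenter τ j) :=
    measurable_from_prod_countable_right fun r => by fun_prop
  have h2 := h.comp (measurable_size.prodMk measurable_sampleMean)
  simp only [Function.comp_def] at h2
  unfold shrunkMean
  exact h2

lemma measurable_localEstimateWith (c τ : ℝ) (mt : ℕ+) (h k : ℕ) :
    Measurable (localEstimateWith c τ mt h (k := k)) := by
  have h1 : Measurable fun q : ℕ × Dataset => projectWith c τ q.1 (shrunkMean τ mt q.1 q.2) :=
    measurable_from_prod_countable_right fun j =>
      (measurable_projectWith c τ j).comp (measurable_shrunkMean τ mt j)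
  have h2 := h1.comp (((measurable_electedBin h).comp measurable_snd).prodMk
    (measurable_fst : Measurable fun p : Dataset × (Fin k → Msg (numBins τ)) => p.1))
  simp only [Function.comp_def] at h2
  unfold localEstimateWith
  exact h2

/-- The estimation channel with projection margin `c τ` and noise level `b τ / α`. -/
def estimationChannelWith (c b α τ : ℝ) (mt : ℕ+) (h k : ℕ) :
    Kernel (Dataset × (Fin k → Msg (numBins τ))) (Msg (numBins τ)) :=
  (Kernel.deterministic (localEstimateWith c τ mt h (k := k))
      (measurable_localEstimateWith c τ mt h k) ×ₖ
    Kernel.const _ laplace).map (fun q => Sum.inr (q.1 + b * τ / α * q.2))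

instance (c b α τ : ℝ) (mt : ℕ+) (h k : ℕ) :
    IsMarkovKernel (estimationChannelWith c b α τ mt h k) :=
  Kernel.IsMarkovKernel.map _ (measurable_inr.comp (by fun_prop))

/-- The DAME mechanism with projection margin `c τ` and noise level `b τ / α`. -/
def dameWith (c b : ℝ) (n : ℕ) (α : ℝ) (mt : ℕ+) :
    Mechanism n Dataset (Msg (numBins (tau n α mt))) where
  channel u :=
    if (u : ℕ) < n / 2 then localisationChannel α (tau n α mt) mt u
    else if (u : ℕ) < 2 * (n / 2) then estimationChannelWith c b α (tau n α mt) mt (n / 2) u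
    else idleChannel (numBins (tau n α mt)) u
  markov u := by
    split_ifs <;> infer_instance

lemma dame_eq_dameWith (n : ℕ) (α : ℝ) (mt : ℕ+) : dame n α mt = dameWith 6 14 n α mt := rfl

/-! ### Privacy -/

lemma flipBit_le_flipBit {α : ℝ} (hα : 0 ≤ α) (b b' : Bool) (S : Set Bool) :
    flipBit α b S ≤ ENNReal.ofReal (Real.exp (α / 6)) * flipBit α b' S := by
  have h1 : 1 ≤ Real.exp (α / 6) := Real.one_le_exp (by positivity)
  by_cases hb : b' = b
  · rw [hb]
    exact le_mul_of_one_le_left' (by simpa using h1)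
  · have hb' : b' = !b := by revert hb; cases b <;> cases b' <;> simp
    have hp : 0 < 1 + Real.exp (α / 6) := by positivity
    subst hb'
    simp only [flipBit, Measure.add_apply, Measure.smul_apply, smul_eq_mul, Bool.not_not, mul_add]
    rw [← mul_assoc, ← mul_assoc, ← ENNReal.ofReal_mul (Real.exp_pos _).le,
      ← ENNReal.ofReal_mul (Real.exp_pos _).le, add_comm]
    gcongr
    · rw [← mul_div_assoc]
      gcongr
      nlinarith
    · rw [mul_one_div]

lemma randomizedResponse_singleton_le {α : ℝ} (hα : 0 ≤ α) {J : ℕ} (v v' y : Fin J → Bool)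
    (hv : (Finset.univ.filter fun j => v j ≠ v' j).card ≤ 6) :
    randomizedResponse α v {y} ≤
      ENNReal.ofReal (Real.exp α) * randomizedResponse α v' {y} := by
  have h1 : 1 ≤ ENNReal.ofReal (Real.exp (α / 6)) := by
    simpa using Real.one_le_exp (by positivity : 0 ≤ α / 6)
  have h6 : ENNReal.ofReal (Real.exp (α / 6)) ^ 6 = ENNReal.ofReal (Real.exp α) := by
    rw [← ENNReal.ofReal_pow (Real.exp_pos _).le, ← Real.exp_nat_mul]
    congr 2
    push_cast
    ring
  simp only [randomizedResponse, Measure.pi_singleton]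
  calc ∏ j, flipBit α (v j) {y j}
      ≤ ∏ j, (if v j ≠ v' j then ENNReal.ofReal (Real.exp (α / 6)) else 1) *
          flipBit α (v' j) {y j} := by
        refine Finset.prod_le_prod' fun j _ => ?_
        split_ifs with hj
        · exact flipBit_le_flipBit hα _ _ _
        · rw [not_not.1 hj, one_mul]
    _ = ENNReal.ofReal (Real.exp (α / 6)) ^ (Finset.univ.filter fun j => v j ≠ v' j).card *
          ∏ j, flipBit α (v' j) {y j} := by
        rw [Finset.prod_mul_distrib, Finset.prod_ite]
        simp
    _ ≤ _ := by
        rw [← h6]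
        gcongr

lemma randomizedResponse_le {α : ℝ} (hα : 0 ≤ α) {J : ℕ} (v v' : Fin J → Bool)
    (hv : (Finset.univ.filter fun j => v j ≠ v' j).card ≤ 6) (S : Set (Fin J → Bool)) :
    randomizedResponse α v S ≤ ENNReal.ofReal (Real.exp α) * randomizedResponse α v' S := by
  classical
  have hS : S = ((Finset.univ.filter fun y => y ∈ S : Finset (Fin J → Bool)) : Set _) := by
    ext; simp
  rw [hS, ← sum_measure_singleton, ← sum_measure_singleton, Finset.mul_sum]
  exact Finset.sum_le_sum fun y _ => randomizedResponse_singleton_le hα v v' y hv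

lemma card_vote_le (τ : ℝ) (mt : ℕ+) (x : Dataset) :
    (Finset.univ.filter fun j => vote τ mt x j = true).card ≤ 3 := by
  set i := binIndex τ (sampleMean x) with hi
  calc (Finset.univ.filter fun j => vote τ mt x j = true).card
      ≤ (Finset.Icc (i - 1) (i + 1)).card := by
        refine Finset.card_le_card_of_injOn (fun j => (j : ℕ)) ?_ Fin.val_injective.injOn
        intro j hj
        simp only [vote, decide_eq_true_eq, Finset.coe_filter, Finset.mem_univ, true_and,
          Set.mem_ofPred_eq, ← hi] at hj
        simp only [Finset.coe_Icc, Set.mem_Icc]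
        omega
    _ ≤ 3 := by
        rw [Nat.card_Icc]
        omega

lemma card_vote_ne_le (τ : ℝ) (mt : ℕ+) (x x' : Dataset) :
    (Finset.univ.filter fun j => vote τ mt x j ≠ vote τ mt x' j).card ≤ 6 := by
  calc _ ≤ ((Finset.univ.filter fun j => vote τ mt x j = true) ∪
        (Finset.univ.filter fun j => vote τ mt x' j = true)).card := by
        refine Finset.card_le_card fun j hj => ?_
        simp only [Finset.mem_filter, Finset.mem_univ, true_and, Finset.mem_union] at hj ⊢
        revert hj
        cases vote τ mt x j <;> cases vote τ mt x' j <;> simp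
    _ ≤ _ := (Finset.card_union_le _ _).trans
        (add_le_add (card_vote_le τ mt x) (card_vote_le τ mt x'))

lemma lintegral_laplace {f : ℝ → ENNReal} (hf : Measurable f) :
    ∫⁻ y, f y ∂laplace = ∫⁻ y, ENNReal.ofReal (Real.exp (-|y|) / 2) * f y := by
  rw [laplace, lintegral_withDensity_eq_lintegral_mul _ (by fun_prop) hf]
  rfl

/-- Shifting standard Laplace noise by `δ` changes its law by a factor of at most `exp |δ|`. -/
lemma lintegral_laplace_shift_le {f : ℝ → ENNReal} (hf : Measurable f) {α δ : ℝ} (hδ : |δ| ≤ α) :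
    ∫⁻ y, f (y - δ) ∂laplace ≤ ENNReal.ofReal (Real.exp α) * ∫⁻ y, f y ∂laplace := by
  rw [lintegral_laplace hf, lintegral_laplace (f := fun y => f (y - δ)) (by fun_prop),
    ← lintegral_const_mul _ (by fun_prop),
    ← lintegral_add_right_eq_self (fun y => ENNReal.ofReal (Real.exp (-|y|) / 2) * f (y - δ)) δ]
  refine lintegral_mono fun y => ?_
  simp only [add_sub_cancel_right]
  rw [← mul_assoc, ← ENNReal.ofReal_mul (Real.exp_pos _).le, ← mul_div_assoc, ← Real.exp_add]
  gcongr
  have := abs_sub_abs_le_abs_sub y (y + δ)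
  rw [show y - (y + δ) = -δ by ring, abs_neg] at this
  linarith

lemma lintegral_estimationChannelWith (c b α τ : ℝ) (mt : ℕ+) (h k : ℕ)
    (p : Dataset × (Fin k → Msg (numBins τ))) {f : Msg (numBins τ) → ENNReal} (hf : Measurable f) :
    ∫⁻ y, f y ∂(estimationChannelWith c b α τ mt h k p) =
      ∫⁻ y, f (Sum.inr (localEstimateWith c τ mt h p + b * τ / α * y)) ∂laplace := by
  have hm : Measurable fun q : ℝ × ℝ => (Sum.inr (q.1 + b * τ / α * q.2) : Msg (numBins τ)) :=
    measurable_inr.comp (by fun_prop)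
  have hfm := hf.comp hm
  simp only [Function.comp_def] at hfm
  rw [estimationChannelWith, Kernel.lintegral_map _ hm _ hf, Kernel.prod_apply,
    lintegral_prod _ hfm.aemeasurable, Kernel.deterministic_apply, Kernel.const_apply,
    lintegral_dirac' _ hfm.lintegral_prod_right']

lemma binLeft_le_one {τ : ℝ} (hτ : 0 < τ) {j : ℕ} (hj : j < numBins τ) : binLeft τ j ≤ 1 := by
  have h : (j : ℝ) < 1 / τ := Nat.lt_ceil.1 hj
  rw [lt_div_iff₀ hτ] at h
  unfold binLeft
  linarith

lemma binRight_le (τ : ℝ) (j : ℕ) : binRight τ j ≤ binLeft τ j + 2 * τ := by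
  refine (min_le_left _ _).trans (le_of_eq ?_)
  unfold binLeft
  ring

lemma projectWith_mem (c τ : ℝ) (j : ℕ) (y : ℝ) :
    max (binLeft τ j - c * τ) (-1) ≤ projectWith c τ j y ∧
      projectWith c τ j y ≤
        max (max (binLeft τ j - c * τ) (-1)) (binLeft τ j + 2 * τ + c * τ) := by
  refine ⟨le_max_left _ _, max_le_max le_rfl ((min_le_left _ _).trans ((min_le_left _ _).trans ?_))⟩
  linarith [binRight_le τ j]

lemma abs_projectWith_sub_le {c τ : ℝ} (hτ : 0 < τ) (hc : 0 ≤ c) (j : ℕ) (y y' : ℝ) :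
    |projectWith c τ j y - projectWith c τ j y'| ≤ (2 + 2 * c) * τ := by
  have h1 := projectWith_mem c τ j y
  have h2 := projectWith_mem c τ j y'
  have h3 : max (max (binLeft τ j - c * τ) (-1)) (binLeft τ j + 2 * τ + c * τ) ≤
      max (binLeft τ j - c * τ) (-1) + (2 + 2 * c) * τ := by
    refine max_le (by nlinarith [mul_nonneg hc hτ.le]) ?_
    have := le_max_left (binLeft τ j - c * τ) (-1)
    linarith
  rw [abs_le]
  constructor <;> linarith [h1.1, h1.2, h2.1, h2.2]

lemma logTerm_ge (n : ℕ) (α : ℝ) (a : ℕ+) : Real.log 8 ≤ logTerm n α a := by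
  unfold logTerm
  refine Real.log_le_log (by norm_num) ?_
  linarith [le_max_right (√(a * (n * α ^ 2))) 1]

lemma log_eight_gt : 2.07 < Real.log 8 := by
  rw [show (8 : ℝ) = 2 ^ 3 by norm_num, Real.log_pow]
  have := Real.log_two_gt_d9
  push_cast
  linarith

lemma logTerm_pos (n : ℕ) (α : ℝ) (a : ℕ+) : 0 < logTerm n α a := by
  linarith [logTerm_ge n α a, log_eight_gt]

lemma tau_pos (n : ℕ) (α : ℝ) (mt : ℕ+) : 0 < tau n α mt := by
  have := logTerm_pos n α mt
  have h2 : (0 : ℝ) < mt := by exact_mod_cast mt.pos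
  exact Real.sqrt_pos.2 (by positivity)

lemma isLDP_dameWith {c b : ℝ} (hc : 0 ≤ c) (hb : 2 + 2 * c ≤ b) (n : ℕ) {α : ℝ} (hα : 0 < α)
    (mt : ℕ+) : (dameWith c b n α mt).IsLDP α := by
  intro u z x x' S hS
  have hτ := tau_pos n α mt
  simp only [dameWith]
  split_ifs with h1 h2
  · simp only [localisationChannel, Kernel.map_apply _ measurable_inl,
      Measure.map_apply measurable_inl hS, Kernel.comap_apply]
    exact randomizedResponse_le hα.le _ _ (card_vote_ne_le _ mt x x') _
  · have hb0 : 0 < b := by linarith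
    rw [← lintegral_indicator_one hS, ← lintegral_indicator_one hS,
      lintegral_estimationChannelWith _ _ _ _ _ _ _ _ (measurable_one.indicator hS),
      lintegral_estimationChannelWith _ _ _ _ _ _ _ _ (measurable_one.indicator hS)]
    set t := localEstimateWith c (tau n α mt) mt (n / 2) (x, z) with ht
    set t' := localEstimateWith c (tau n α mt) mt (n / 2) (x', z) with ht'
    set s := b * tau n α mt / α with hs
    have hs0 : 0 < s := by positivity
    have hδ : |(t' - t) / s| ≤ α := by
      rw [abs_div, abs_of_pos hs0, div_le_iff₀ hs0, hs, mul_div_cancel₀ _ hα.ne']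
      refine (abs_projectWith_sub_le hτ hc _ _ _).trans ?_
      gcongr
    have hm : Measurable fun y : ℝ =>
        S.indicator (1 : Msg (numBins (tau n α mt)) → ENNReal) (Sum.inr (t' + s * y)) :=
      (measurable_one.indicator hS).comp (measurable_inr.comp (by fun_prop))
    have h := lintegral_laplace_shift_le hm hδ
    refine le_trans (le_of_eq (lintegral_congr fun y => ?_)) h
    congr 2
    field_simp
    ring
  · simp only [idleChannel, Kernel.const_apply]
    exact le_mul_of_one_le_left' (by simpa using Real.one_le_exp hα.le)

/-! ### Geometry of the bins -/

lemma numBins_pos {τ : ℝ} (hτ : 0 < τ) : 0 < numBins τ := Nat.ceil_pos.2 (by positivity)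

lemma one_le_numBins_mul {τ : ℝ} (hτ : 0 < τ) : 1 ≤ numBins τ * τ := by
  have h : 1 / τ ≤ numBins τ := Nat.le_ceil _
  rwa [div_le_iff₀ hτ] at h

lemma numBins_sub_one_le {τ : ℝ} (hτ : 0 < τ) : (numBins τ : ℝ) - 1 ≤ 1 / τ := by
  have := Nat.ceil_lt_add_one (by positivity : 0 ≤ 1 / τ)
  unfold numBins
  linarith

lemma binIndex_lt {τ : ℝ} (hτ : 0 < τ) (y : ℝ) : binIndex τ y < numBins τ := by
  have := numBins_pos hτ
  unfold binIndex
  omega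

lemma binLeft_binIndex_le {τ y : ℝ} (hτ : 0 < τ) (hy : -1 ≤ y) :
    binLeft τ (binIndex τ y) ≤ y := by
  have h0 : 0 ≤ (y + 1) / (2 * τ) := div_nonneg (by linarith) (by linarith)
  have h1 : (binIndex τ y : ℝ) ≤ (y + 1) / (2 * τ) :=
    (Nat.cast_le.2 (min_le_left _ _)).trans (Nat.floor_le h0)
  rw [le_div_iff₀ (by linarith)] at h1
  unfold binLeft
  linarith

lemma le_binRight_binIndex {τ y : ℝ} (hτ : 0 < τ) (hy : y ≤ 1) :
    y ≤ binRight τ (binIndex τ y) := by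
  refine le_min ?_ hy
  unfold binIndex
  rcases le_total ⌊(y + 1) / (2 * τ)⌋₊ (numBins τ - 1) with h | h
  · rw [min_eq_left h]
    have := Nat.lt_floor_add_one ((y + 1) / (2 * τ))
    rw [div_lt_iff₀ (by linarith)] at this
    linarith
  · rw [min_eq_right h, Nat.cast_sub (numBins_pos hτ)]
    have := one_le_numBins_mul hτ
    push_cast
    linarith

lemma binIndex_le_add_one {τ y y' : ℝ} (hτ : 0 < τ) (hy' : -1 ≤ y') (h : y ≤ y' + τ) :
    binIndex τ y ≤ binIndex τ y' + 1 := by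
  have h1 : ⌊(y + 1) / (2 * τ)⌋₊ ≤ ⌊(y' + 1) / (2 * τ)⌋₊ + 1 := by
    rw [← Nat.floor_add_one (div_nonneg (by linarith) (by linarith))]
    refine Nat.floor_le_floor ?_
    rw [div_le_iff₀ (by linarith), add_mul, div_mul_cancel₀ _ (by linarith)]
    linarith
  unfold binIndex
  omega

lemma binLeft_le_binRight {τ : ℝ} (hτ : 0 < τ) {j : ℕ} (hj : j < numBins τ) :
    binLeft τ j ≤ binRight τ j := by
  refine le_min ?_ (binLeft_le_one hτ hj)
  unfold binLeft
  linarith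

/-- Bin `j` is at most two bins away from the bin of `y`. -/
def IsNear (τ y : ℝ) (j : ℕ) : Prop :=
  j < numBins τ ∧ j ≤ binIndex τ y + 2 ∧ binIndex τ y ≤ j + 2

section near

variable {τ y : ℝ} {j : ℕ}

lemma IsNear.sub_le (hτ : 0 < τ) (hy : |y| ≤ 1) (h : IsNear τ y j) :
    binLeft τ j - 4 * τ ≤ y := by
  have h1 := binLeft_binIndex_le hτ (abs_le.1 hy).1
  have h2 : (j : ℝ) ≤ binIndex τ y + 2 := by exact_mod_cast h.2.1
  unfold binLeft at *
  nlinarith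

lemma IsNear.le_add (hτ : 0 < τ) (hy : |y| ≤ 1) (h : IsNear τ y j) :
    y ≤ binRight τ j + 4 * τ := by
  have h1 := le_binRight_binIndex hτ (abs_le.1 hy).2
  have h3 : (binIndex τ y : ℝ) ≤ j + 2 := by exact_mod_cast h.2.2
  have h4 : y ≤ -1 + 2 * τ * (binIndex τ y + 1) := h1.trans (min_le_left _ _)
  have h5 : binRight τ j = -1 + 2 * τ * (j + 1) ∨ binRight τ j = 1 := min_choice _ _
  rcases h5 with h5 | h5 <;> rw [h5]
  · nlinarith
  · linarith [(abs_le.1 hy).2]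

lemma IsNear.abs_binCenter_sub_le (hτ : 0 < τ) (hy : |y| ≤ 1) (h : IsNear τ y j) :
    |binCenter τ j - y| ≤ 5 * τ := by
  have h1 := h.sub_le hτ hy
  have h2 := h.le_add hτ hy
  have h3 := binRight_le τ j
  unfold binCenter
  rw [abs_le]
  constructor <;> linarith [binLeft_le_binRight hτ h.1]

end near

lemma abs_binCenter_le {τ : ℝ} (hτ : 0 < τ) {j : ℕ} (hj : j < numBins τ) :
    |binCenter τ j| ≤ 1 := by
  have h1 := binLeft_le_one hτ hj
  have h2 := binLeft_le_binRight hτ hj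
  have h3 : binRight τ j ≤ 1 := min_le_right _ _
  have h4 : -1 ≤ binLeft τ j := by
    unfold binLeft
    have : (0 : ℝ) ≤ 2 * τ * j := by positivity
    linarith
  unfold binCenter
  rw [abs_le]
  constructor <;> linarith

lemma abs_clamp_sub_le {lo hi y t : ℝ} (h1 : lo ≤ t) (h2 : t ≤ hi) :
    |max lo (min hi y) - t| ≤ |y - t| := by
  have e : t = max lo (min hi t) := by rw [min_eq_right h2, max_eq_right h1]
  conv_lhs => rw [e]
  refine (abs_max_sub_max_le_max _ _ _ _).trans (max_le (by simp) ?_)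
  exact (abs_min_sub_min_le_max _ _ _ _).trans (max_le (by simp) le_rfl)

/-! ### Weights -/

/-- The weight `√((k ∧ mt) / mt)` of the sample mean of a data set of size `k`. -/
def weight (mt : ℕ+) (k : ℕ) : ℝ := √((min k mt : ℕ) : ℝ) / √(mt : ℝ)

lemma weight_nonneg (mt : ℕ+) (k : ℕ) : 0 ≤ weight mt k := by
  unfold weight
  positivity

lemma weight_le_one (mt : ℕ+) (k : ℕ) : weight mt k ≤ 1 :=
  div_le_one_of_le₀ (Real.sqrt_le_sqrt (by exact_mod_cast min_le_right _ _)) (Real.sqrt_nonneg _)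

lemma weight_eq_one {mt : ℕ+} {k : ℕ} (h : (mt : ℕ) ≤ k) : weight mt k = 1 := by
  have h2 : (0 : ℝ) < mt := by exact_mod_cast mt.pos
  rw [weight, min_eq_right h, div_self (Real.sqrt_pos.2 h2).ne']

lemma weight_sq_div_le (mt : ℕ+) (k : ℕ+) : weight mt k ^ 2 / (k : ℝ) ≤ 1 / mt := by
  have h1 : (0 : ℝ) < k := by exact_mod_cast k.pos
  have h2 : (0 : ℝ) < mt := by exact_mod_cast mt.pos
  have h3 : ((min (k : ℕ) mt : ℕ) : ℝ) ≤ (k : ℝ) := by exact_mod_cast min_le_left _ _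
  rw [weight, div_pow, Real.sq_sqrt (Nat.cast_nonneg _), Real.sq_sqrt h2.le, div_div,
    div_le_div_iff₀ (by positivity) h2]
  nlinarith

lemma shrunkMean_eq (τ : ℝ) (mt : ℕ+) (j : ℕ) (x : Dataset) :
    shrunkMean τ mt j x = weight mt x.1 * sampleMean x + (1 - weight mt x.1) * binCenter τ j := by
  have h2 : (0 : ℝ) < mt := by exact_mod_cast mt.pos
  have h1 : (0 : ℝ) < ((min (x.1 : ℕ) mt : ℕ) : ℝ) := by
    exact_mod_cast lt_min x.1.pos mt.pos
  have h3 := (Real.sqrt_pos.2 h1).ne'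
  have h4 := (Real.sqrt_pos.2 h2).ne'
  unfold shrunkMean weight
  field_simp

/-- The weighted deviation of the sample mean. -/
def dev (mt : ℕ+) (θ : ℝ) (x : Dataset) : ℝ := weight mt x.1 * (sampleMean x - θ)

lemma measurable_dev (mt : ℕ+) (θ : ℝ) : Measurable (dev mt θ) := by
  have h : Measurable fun x : Dataset => weight mt x.1 :=
    (measurable_of_countable (weight mt)).comp measurable_size
  exact h.mul (measurable_sampleMean.sub_const θ)

lemma abs_dev_le (mt : ℕ+) {θ : ℝ} (hθ : |θ| ≤ 1) (x : Dataset) : |dev mt θ x| ≤ 2 := by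
  have h1 : |sampleMean x - θ| ≤ 2 := by
    have h2 := abs_sub_le (sampleMean x) 0 θ
    have h3 := abs_sampleMean_le x
    simp only [sub_zero, zero_sub, abs_neg] at h2
    linarith
  rw [dev, abs_mul, abs_of_nonneg (weight_nonneg mt _)]
  nlinarith [weight_le_one mt x.1, weight_nonneg mt x.1, abs_nonneg (sampleMean x - θ)]

lemma abs_shrunkMean_le {τ : ℝ} (hτ : 0 < τ) (mt : ℕ+) {j : ℕ} (hj : j < numBins τ)
    (x : Dataset) : |shrunkMean τ mt j x| ≤ 1 := by
  have h1 := abs_le.1 (abs_sampleMean_le x)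
  have h2 := abs_le.1 (abs_binCenter_le hτ hj)
  have h3 := weight_nonneg mt x.1
  have h4 := weight_le_one mt x.1
  rw [shrunkMean_eq, abs_le]
  constructor <;> nlinarith

lemma abs_projectWith_shrunkMean_sub_le {c τ y : ℝ} (hτ : 0 < τ) (hc : 5 ≤ c) (hy : |y| ≤ 1)
    (mt : ℕ+) {j : ℕ} (h : IsNear τ y j) (x : Dataset) :
    |projectWith c τ j (shrunkMean τ mt j x) - y| ≤ |dev mt y x| + 5 * τ := by
  have h1 := h.sub_le hτ hy
  have h2 := h.le_add hτ hy
  have h5 : 5 * τ ≤ c * τ := by gcongr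
  have h6 := h.abs_binCenter_sub_le hτ hy
  have h7 := abs_le.1 hy
  refine (abs_clamp_sub_le (max_le (by linarith) h7.1) (le_min (by linarith) h7.2)).trans ?_
  have e : shrunkMean τ mt j x - y =
      dev mt y x + (1 - weight mt x.1) * (binCenter τ j - y) := by
    rw [shrunkMean_eq, dev]
    ring
  rw [e]
  refine (abs_add_le _ _).trans (add_le_add le_rfl ?_)
  rw [abs_mul, abs_of_nonneg (sub_nonneg.2 (weight_le_one mt _))]
  nlinarith [weight_nonneg mt x.1, abs_nonneg (binCenter τ j - y)]

/-- Projecting moves the shrunk mean only if its deviation exceeds `τ`. -/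
lemma abs_projectWith_shrunkMean_sub_self_le {c τ y : ℝ} (hτ : 0 < τ) (hc : 5 ≤ c) (hy : |y| ≤ 1)
    (mt : ℕ+) {j : ℕ} (h : IsNear τ y j) (x : Dataset) :
    |projectWith c τ j (shrunkMean τ mt j x) - shrunkMean τ mt j x| ≤
      max (|dev mt y x| - τ) 0 := by
  have h1 := h.sub_le hτ hy
  have h2 := h.le_add hτ hy
  have h3 := binLeft_le_binRight hτ h.1
  have h5 : 5 * τ ≤ c * τ := by gcongr
  have hw0 := weight_nonneg mt x.1
  have hw1 := weight_le_one mt x.1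
  have hs := abs_le.1 (abs_shrunkMean_le hτ mt h.1 x)
  have e : shrunkMean τ mt j x =
      dev mt y x + (weight mt x.1 * y + (1 - weight mt x.1) * binCenter τ j) := by
    rw [shrunkMean_eq, dev]
    ring
  set u := weight mt x.1 * y + (1 - weight mt x.1) * binCenter τ j with hu
  have hu1 : binLeft τ j - c * τ + τ ≤ u := by
    have : binLeft τ j - c * τ + τ ≤ binCenter τ j := by unfold binCenter; linarith
    nlinarith
  have hu2 : u ≤ binRight τ j + c * τ - τ := by
    have : binCenter τ j ≤ binRight τ j + c * τ - τ := by unfold binCenter; linarith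
    nlinarith
  set v := shrunkMean τ mt j x
  have hd1 := neg_abs_le (dev mt y x)
  have hd2 := le_abs_self (dev mt y x)
  unfold projectWith
  rcases le_total v (max (binLeft τ j - c * τ) (-1)) with hv | hv
  · have hv2 : max (max (binLeft τ j - c * τ) (-1)) (min (min (binRight τ j + c * τ) 1) v) =
        max (binLeft τ j - c * τ) (-1) := max_eq_left ((min_le_right _ _).trans hv)
    rw [hv2, abs_of_nonneg (sub_nonneg.2 hv)]
    rcases max_choice (binLeft τ j - c * τ) (-1) with hm | hm <;> rw [hm]
    · exact le_max_of_le_left (by linarith)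
    · exact le_max_of_le_right (by linarith)
  · rcases le_total v (min (binRight τ j + c * τ) 1) with hv' | hv'
    · rw [min_eq_right hv', max_eq_right hv, sub_self, abs_zero]
      exact le_max_right _ _
    · rw [min_eq_left hv']
      have hl : max (binLeft τ j - c * τ) (-1) ≤ min (binRight τ j + c * τ) 1 := by
        have h7 := abs_le.1 hy
        have h8 := binLeft_le_one hτ h.1
        exact max_le (le_min (by linarith) (by linarith)) (le_min (by linarith) (by linarith))
      rw [max_eq_right hl, abs_of_nonpos (sub_nonpos.2 hv'), neg_sub]
      rcases min_choice (binRight τ j + c * τ) 1 with hm | hm <;> rw [hm]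
      · exact le_max_of_le_left (by linarith)
      · exact le_max_of_le_right (by linarith)

/-! ### Moments of the deviation of the sample mean -/

section moments

variable (M : PMF ℕ+) (μ : Measure Obs) [IsProbabilityMeasure μ] (mt : ℕ+)

lemma integrable_of_abs_le {f : Dataset → ℝ} (hf : Measurable f) (B : ℝ) (hB : ∀ x, |f x| ≤ B) :
    Integrable f (dataLaw M μ) :=
  Integrable.of_bound hf.aestronglyMeasurable B (Filter.Eventually.of_forall hB)

lemma abs_exp_dev_le {θ : ℝ} (hθ : |θ| ≤ 1) (t : ℝ) (x : Dataset) :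
    |Real.exp (t * dev mt θ x)| ≤ Real.exp (|t| * 2) := by
  rw [abs_of_pos (Real.exp_pos _), Real.exp_le_exp]
  refine (le_abs_self _).trans ?_
  rw [abs_mul]
  exact mul_le_mul_of_nonneg_left (abs_dev_le mt hθ x) (abs_nonneg t)

lemma measurable_exp_dev (θ t : ℝ) : Measurable fun x => Real.exp (t * dev mt θ x) :=
  Real.measurable_exp.comp ((measurable_dev mt θ).const_mul t)

lemma integrable_exp_dev {θ : ℝ} (hθ : |θ| ≤ 1) (t : ℝ) :
    Integrable (fun x => Real.exp (t * dev mt θ x)) (dataLaw M μ) :=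
  integrable_of_abs_le M μ (measurable_exp_dev mt θ t) _ (abs_exp_dev_le mt hθ t)

lemma integral_exp_dev_pi_le (t : ℝ) (k : ℕ+) :
    ∫ x, Real.exp (t * dev mt (mean μ) ⟨k, x⟩) ∂(Measure.pi fun _ : Fin (k : ℕ) => μ) ≤
      Real.exp (t ^ 2 / (2 * mt)) := by
  have h := integral_exp_sampleMean_le μ k (t * weight mt k)
  simp only [dev, ← mul_assoc]
  refine h.trans (Real.exp_le_exp.2 ?_)
  have h1 : (0 : ℝ) < k := by exact_mod_cast k.pos
  have h2 : (0 : ℝ) < mt := by exact_mod_cast mt.pos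
  have h3 := mul_le_mul_of_nonneg_left (weight_sq_div_le mt k) (by positivity : 0 ≤ t ^ 2 / 2)
  calc (t * weight mt k) ^ 2 / (2 * k) = t ^ 2 / 2 * (weight mt k ^ 2 / k) := by
        field_simp
    _ ≤ _ := h3
    _ = _ := by field_simp

lemma integral_exp_dev_le (t : ℝ) :
    ∫ x, Real.exp (t * dev mt (mean μ) x) ∂(dataLaw M μ) ≤ Real.exp (t ^ 2 / (2 * mt)) :=
  integral_dataLaw_le M μ (measurable_exp_dev mt _ t) _ (abs_exp_dev_le mt (abs_mean_le μ) t)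
    (integral_exp_dev_pi_le μ mt t)

lemma sq_le_exp_add_exp (y : ℝ) : y ^ 2 ≤ Real.exp y + Real.exp (-y) - 2 := by
  have h1 : (y / 2) ^ 2 ≤ Real.sinh (y / 2) ^ 2 := by
    rw [sq_le_sq, Real.abs_sinh]
    exact Real.self_le_sinh_iff.2 (abs_nonneg _)
  have h2 := Real.cosh_two_mul (y / 2)
  rw [mul_div_cancel₀ y two_ne_zero, Real.cosh_sq] at h2
  rw [Real.cosh_eq] at h2
  linarith

lemma exp_half_le : Real.exp (1 / 2) ≤ 1.65 := by
  have h := Real.exp_one_lt_d9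
  have h2 : Real.exp (1 / 2) ^ 2 = Real.exp 1 := by
    rw [← Real.exp_nat_mul]
    norm_num
  nlinarith [Real.exp_pos (1 / 2)]

lemma integral_dev_sq_le : ∫ x, dev mt (mean μ) x ^ 2 ∂(dataLaw M μ) ≤ 1.3 / mt := by
  have h2 : (0 : ℝ) < mt := by exact_mod_cast mt.pos
  have hθ := abs_mean_le μ
  have e := Real.sq_sqrt h2.le
  have hi1 := integrable_exp_dev M μ mt hθ (√mt)
  have hi2 := integrable_exp_dev M μ mt hθ (-√mt)
  have h3 := integral_exp_dev_le M μ mt (√mt)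
  have h4 := integral_exp_dev_le M μ mt (-√mt)
  have e1 : √(mt : ℝ) ^ 2 / (2 * mt) = 1 / 2 := by rw [e]; field_simp
  rw [neg_sq, e1] at h4
  rw [e1] at h3
  have hint : ∫ x, mt * dev mt (mean μ) x ^ 2 ∂(dataLaw M μ) ≤
      ∫ x, (Real.exp (√mt * dev mt (mean μ) x) + Real.exp (-√mt * dev mt (mean μ) x) - 2)
        ∂(dataLaw M μ) := by
    refine integral_mono_of_nonneg (Filter.Eventually.of_forall fun x => by positivity)
      ((hi1.add hi2).sub (integrable_const 2)) (Filter.Eventually.of_forall fun x => ?_)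
    have h := sq_le_exp_add_exp (√mt * dev mt (mean μ) x)
    rw [mul_pow, e, ← neg_mul] at h
    exact h
  have hadd : Integrable (fun x => Real.exp (√mt * dev mt (mean μ) x) +
      Real.exp (-√mt * dev mt (mean μ) x)) (dataLaw M μ) := hi1.add hi2
  rw [integral_const_mul, integral_sub hadd (integrable_const 2), integral_add hi1 hi2] at hint
  simp only [integral_const, probReal_univ, smul_eq_mul, one_mul] at hint
  rw [le_div_iff₀ h2]
  linarith [exp_half_le]

lemma excess_le_exp {l : ℝ} (hl : 0 < l) (d τ : ℝ) :
    max (|d| - τ) 0 ≤ Real.exp (-(l * τ)) / l * (Real.exp (l * d) + Real.exp (-l * d)) := by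
  have h1 : Real.exp (l * |d|) ≤ Real.exp (l * d) + Real.exp (-l * d) := by
    rcases abs_choice d with h | h <;> rw [h]
    · linarith [Real.exp_pos (-l * d)]
    · rw [mul_neg, ← neg_mul]
      linarith [Real.exp_pos (l * d)]
  refine max_le ?_ (by positivity)
  calc |d| - τ ≤ Real.exp (l * (|d| - τ)) / l := by
        rw [le_div_iff₀ hl]
        linarith [Real.add_one_le_exp (l * (|d| - τ))]
    _ = Real.exp (-(l * τ)) / l * Real.exp (l * |d|) := by
        rw [mul_sub, sub_eq_add_neg, Real.exp_add]
        ring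
    _ ≤ _ := by gcongr

lemma integral_excess_le {τ : ℝ} (hτ : 0 < τ) :
    ∫ x, max (|dev mt (mean μ) x| - τ) 0 ∂(dataLaw M μ) ≤
      2 * Real.exp (-(mt * τ ^ 2 / 2)) / (mt * τ) := by
  have h2 : (0 : ℝ) < mt := by exact_mod_cast mt.pos
  have hθ := abs_mean_le μ
  have hl : 0 < mt * τ := by positivity
  have hi1 := integrable_exp_dev M μ mt hθ (mt * τ)
  have hi2 := integrable_exp_dev M μ mt hθ (-(mt * τ))
  have h3 := integral_exp_dev_le M μ mt (mt * τ)
  have h4 := integral_exp_dev_le M μ mt (-(mt * τ))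
  rw [neg_sq] at h4
  have hint := integral_mono_of_nonneg (μ := dataLaw M μ)
    (f := fun x => max (|dev mt (mean μ) x| - τ) 0)
    (Filter.Eventually.of_forall fun x => le_max_right _ _)
    ((hi1.add hi2).const_mul (Real.exp (-(mt * τ * τ)) / (mt * τ)))
    (Filter.Eventually.of_forall fun x => excess_le_exp hl (dev mt (mean μ) x) τ)
  rw [integral_const_mul, integral_add' hi1 hi2] at hint
  refine hint.trans ?_
  calc _ ≤ Real.exp (-(mt * τ * τ)) / (mt * τ) * (2 * Real.exp ((mt * τ) ^ 2 / (2 * mt))) := by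
        gcongr
        linarith
    _ = 2 * (Real.exp (-(mt * τ * τ)) * Real.exp ((mt * τ) ^ 2 / (2 * mt))) / (mt * τ) := by ring
    _ = _ := by
        rw [← Real.exp_add]
        congr 3
        field_simp
        ring

lemma hasSum_tailProb (a : ℕ+) (q : ℝ) :
    HasSum (fun k => (M k).toReal * if a ≤ k then q else 0) (tailProb M a * q) := by
  have h : Summable fun k : ℕ+ => if a ≤ k then (M k).toReal else 0 := by
    refine Summable.of_nonneg_of_le (fun k => ?_) (fun k => ?_) (hasSum_toReal M).summable
    · split_ifs
      · exact ENNReal.toReal_nonneg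
      · exact le_rfl
    · split_ifs
      · exact le_rfl
      · exact ENNReal.toReal_nonneg
  have h2 := h.hasSum.mul_right q
  simp only [ite_mul, zero_mul] at h2
  simp only [mul_ite, mul_zero]
  exact h2

/-- The event that a user has at least `mt` observations but her sample mean is off by `τ`. -/
def IsMisled (τ θ : ℝ) (x : Dataset) : Prop := (mt : ℕ) ≤ (x.1 : ℕ) ∧ τ < |sampleMean x - θ|

lemma measureReal_le_of_isMisled {τ : ℝ} (hτ : 0 < τ) {s : Set Dataset} (hs : MeasurableSet s)
    (h : ∀ x ∈ s, IsMisled mt τ (mean μ) x) :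
    (dataLaw M μ).real s ≤ tailProb M mt * (2 * Real.exp (-(mt * τ ^ 2 / 2))) := by
  have h2 : (0 : ℝ) < mt := by exact_mod_cast mt.pos
  have hl : 0 < mt * τ := by positivity
  rw [← integral_indicator_one hs]
  refine integral_dataLaw_le_of_hasSum M μ (measurable_one.indicator hs) 1 (fun x => ?_)
    (hasSum_tailProb M mt _) fun k => ?_
  · by_cases hx : x ∈ s <;> simp [hx]
  · split_ifs with hk
    · have hb : ∀ t : ℝ, Integrable (fun x => Real.exp (t * dev mt (mean μ) ⟨k, x⟩))
          (Measure.pi fun _ : Fin (k : ℕ) => μ) := fun t =>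
        Integrable.of_bound
          ((measurable_exp_dev mt _ t).comp (measurable_sigmaMk k)).aestronglyMeasurable _
          (Filter.Eventually.of_forall fun x => abs_exp_dev_le mt (abs_mean_le μ) t _)
      have h3 := integral_exp_dev_pi_le μ mt (mt * τ) k
      have h4 := integral_exp_dev_pi_le μ mt (-(mt * τ)) k
      rw [neg_sq] at h4
      have hint := integral_mono_of_nonneg (μ := Measure.pi fun _ : Fin (k : ℕ) => μ)
        (f := fun x => s.indicator (1 : Dataset → ℝ) ⟨k, x⟩)
        (Filter.Eventually.of_forall fun x => Set.indicator_nonneg (fun _ _ => zero_le_one) _)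
        (((hb (mt * τ)).add (hb (-(mt * τ)))).const_mul (Real.exp (-(mt * τ * τ))))
        (Filter.Eventually.of_forall fun x => ?_)
      · rw [integral_const_mul, integral_add' (hb _) (hb _)] at hint
        refine hint.trans ?_
        calc _ ≤ Real.exp (-(mt * τ * τ)) * (2 * Real.exp ((mt * τ) ^ 2 / (2 * mt))) := by
              gcongr
              linarith
          _ = 2 * (Real.exp (-(mt * τ * τ)) * Real.exp ((mt * τ) ^ 2 / (2 * mt))) := by ring
          _ = _ := by
              rw [← Real.exp_add]
              congr 2
              field_simp
              ring
      · have hpos : 0 ≤ Real.exp (-(mt * τ * τ)) * (Real.exp (mt * τ * dev mt (mean μ) ⟨k, x⟩) +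
            Real.exp (-(mt * τ) * dev mt (mean μ) ⟨k, x⟩)) := by positivity
        by_cases hx : (⟨k, x⟩ : Dataset) ∈ s
        · have hx2 := (h _ hx).2
          have hd : dev mt (mean μ) ⟨k, x⟩ = sampleMean ⟨k, x⟩ - mean μ := by
            rw [dev, weight_eq_one (h _ hx).1, one_mul]
          rw [← hd] at hx2
          simp only [Set.indicator_of_mem hx, Pi.one_apply, Pi.add_apply, mul_add, ← Real.exp_add]
          rcases lt_abs.1 hx2 with hx3 | hx3
          · have := Real.one_le_exp (x := -(mt * τ * τ) + mt * τ * dev mt (mean μ) ⟨k, x⟩)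
              (by nlinarith)
            linarith [Real.exp_pos (-(mt * τ * τ) + -(mt * τ) * dev mt (mean μ) ⟨k, x⟩)]
          · have := Real.one_le_exp (x := -(mt * τ * τ) + -(mt * τ) * dev mt (mean μ) ⟨k, x⟩)
              (by nlinarith)
            linarith [Real.exp_pos (-(mt * τ * τ) + mt * τ * dev mt (mean μ) ⟨k, x⟩)]
        · exact (Set.indicator_of_notMem hx _).trans_le hpos
    · refine le_of_eq (integral_eq_zero_of_ae (Filter.Eventually.of_forall fun x => ?_))
      have hx : (⟨k, x⟩ : Dataset) ∉ s := fun hx => hk (h _ hx).1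
      simp [hx]

end moments

/-! ### Localisation -/

/-- A bit as a real number. -/
def bit (b : Bool) : ℝ := if b = true then 1 else 0

lemma bit_nonneg (b : Bool) : 0 ≤ bit b := by unfold bit; split_ifs <;> norm_num

lemma bit_le_one (b : Bool) : bit b ≤ 1 := by unfold bit; split_ifs <;> norm_num

/-- The contraction factor `tanh (α / 12)` of randomised response. -/
def rrFactor (α : ℝ) : ℝ := (Real.exp (α / 6) - 1) / (1 + Real.exp (α / 6))

lemma rrFactor_nonneg {α : ℝ} (hα : 0 ≤ α) : 0 ≤ rrFactor α :=
  div_nonneg (sub_nonneg.2 (Real.one_le_exp (by positivity))) (by positivity)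

lemma integral_bit_flipBit (α : ℝ) (b : Bool) :
    ∫ y, bit y ∂(flipBit α b) = 1 / (1 + Real.exp (α / 6)) + rrFactor α * bit b := by
  have hp : 0 < 1 + Real.exp (α / 6) := by positivity
  have hi : ∀ ν : Measure Bool, IsFiniteMeasure ν → Integrable bit ν := fun ν _ =>
    Integrable.of_finite
  rw [flipBit, integral_add_measure, integral_smul_measure, integral_smul_measure,
    integral_dirac, integral_dirac, ENNReal.toReal_ofReal (by positivity),
    ENNReal.toReal_ofReal (by positivity), rrFactor]
  · cases b
    · simp [bit]
    · simp [bit]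
      field_simp
      ring
  · exact (hi _ inferInstance).smul_measure ENNReal.ofReal_ne_top
  · exact (hi _ inferInstance).smul_measure ENNReal.ofReal_ne_top

lemma integral_bit_randomizedResponse (α : ℝ) {J : ℕ} (v : Fin J → Bool) (j : Fin J) :
    ∫ y, bit (y j) ∂(randomizedResponse α v) =
      1 / (1 + Real.exp (α / 6)) + rrFactor α * bit (v j) := by
  rw [← integral_bit_flipBit]
  exact integral_comp_eval (μ := fun j => flipBit α (v j)) (i := j) (f := bit)
    (measurable_of_countable bit).aestronglyMeasurable

/-- Randomised response as a kernel. -/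
def responseKernel (α : ℝ) (J : ℕ) : Kernel (Fin J → Bool) (Fin J → Bool) :=
  Kernel.ofFunOfCountable (randomizedResponse α)

instance (α : ℝ) (J : ℕ) : IsMarkovKernel (responseKernel α J) :=
  ⟨fun v => inferInstanceAs (IsProbabilityMeasure (randomizedResponse α v))⟩

/-- The kernel that privatises the votes of a data set. -/
def voteKernel (α τ : ℝ) (mt : ℕ+) : Kernel Dataset (Fin (numBins τ) → Bool) :=
  (responseKernel α (numBins τ)).comap (vote τ mt) (measurable_vote τ mt)

instance (α τ : ℝ) (mt : ℕ+) : IsMarkovKernel (voteKernel α τ mt) := by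
  unfold voteKernel
  infer_instance

lemma voteKernel_apply (α τ : ℝ) (mt : ℕ+) (x : Dataset) :
    voteKernel α τ mt x = randomizedResponse α (vote τ mt x) := rfl

lemma lintegral_localisationChannel (α τ : ℝ) (mt : ℕ+) (k : ℕ)
    (p : Dataset × (Fin k → Msg (numBins τ))) {f : Msg (numBins τ) → ENNReal} (hf : Measurable f) :
    ∫⁻ y, f y ∂(localisationChannel α τ mt k p) =
      ∫⁻ y, f (Sum.inl y) ∂(voteKernel α τ mt p.1) := by
  rw [localisationChannel, Kernel.lintegral_map _ measurable_inl _ hf]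
  rfl

section separation

variable (M : PMF ℕ+) (μ : Measure Obs) [IsProbabilityMeasure μ] (mt : ℕ+)

lemma measurableSet_vote (τ : ℝ) (j : Fin (numBins τ)) :
    MeasurableSet {x | vote τ mt x j = true} :=
  ((measurable_pi_apply j).comp (measurable_vote τ mt)) (measurableSet_singleton true)

lemma measureReal_vote_le {τ : ℝ} (hτ : 0 < τ) {j : Fin (numBins τ)}
    (hj : ¬ IsNear τ (mean μ) j) :
    (dataLaw M μ).real {x | vote τ mt x j = true} ≤
      tailProb M mt * (2 * Real.exp (-(mt * τ ^ 2 / 2))) := by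
  refine measureReal_le_of_isMisled M μ mt hτ (measurableSet_vote mt τ j) fun x hx => ?_
  simp only [vote, decide_eq_true_eq, Set.mem_ofPred_eq] at hx
  refine ⟨hx.1, lt_of_not_ge fun h => hj ⟨j.2, ?_⟩⟩
  have h1 := abs_le.1 h
  have h2 := binIndex_le_add_one hτ (abs_le.1 (abs_mean_le μ)).1
    (by linarith : sampleMean x ≤ mean μ + τ)
  have h3 := binIndex_le_add_one hτ (abs_le.1 (abs_sampleMean_le x)).1
    (by linarith : mean μ ≤ sampleMean x + τ)
  omega

lemma measureReal_size_ge : (dataLaw M μ).real {x : Dataset | (mt : ℕ) ≤ x.1} = tailProb M mt := by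
  have hs : MeasurableSet {x : Dataset | (mt : ℕ) ≤ x.1} := measurable_size measurableSet_Ici
  rw [← integral_indicator_one hs]
  have h := hasSum_integral_dataLaw M μ (measurable_one.indicator hs) 1 (fun x => by
    by_cases hx : x ∈ {x : Dataset | (mt : ℕ) ≤ x.1} <;> simp only [Set.indicator, hx] <;> simp)
  have h2 := hasSum_tailProb M mt 1
  rw [mul_one] at h2
  refine h.unique ?_
  convert h2 using 2 with k
  congr 1
  by_cases hk : mt ≤ k <;> simp [Set.indicator, hk]

lemma le_measureReal_vote {τ : ℝ} (hτ : 0 < τ) (j : Fin (numBins τ))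
    (hj : (j : ℕ) = binIndex τ (mean μ)) :
    tailProb M mt - tailProb M mt * (2 * Real.exp (-(mt * τ ^ 2 / 2))) ≤
      (dataLaw M μ).real {x | vote τ mt x j = true} := by
  have hs : MeasurableSet {x : Dataset | (mt : ℕ) ≤ x.1} := measurable_size measurableSet_Ici
  have h1 := measureReal_le_of_isMisled M μ mt hτ
    (hs.diff (measurableSet_vote mt τ j)) fun x hx => by
      refine ⟨hx.1, lt_of_not_ge fun h => hx.2 ?_⟩
      have h1 := abs_le.1 h
      have h2 := binIndex_le_add_one hτ (abs_le.1 (abs_mean_le μ)).1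
        (by linarith : sampleMean x ≤ mean μ + τ)
      have h3 := binIndex_le_add_one hτ (abs_le.1 (abs_sampleMean_le x)).1
        (by linarith : mean μ ≤ sampleMean x + τ)
      have h4 : (mt : ℕ) ≤ x.1 := hx.1
      simp only [vote, decide_eq_true_eq, Set.mem_ofPred_eq, hj]
      exact ⟨h4, h2, h3⟩
  rw [← measureReal_size_ge M μ mt] at h1 ⊢
  have h2 := le_measureReal_sdiff (μ := dataLaw M μ) (s₁ := {x : Dataset | (mt : ℕ) ≤ x.1})
    (s₂ := {x | vote τ mt x j = true})
  linarith

/-- The separation of the vote probabilities of the bin of the mean and of a remote bin, after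
randomised response. -/
def separation (α τ : ℝ) : ℝ :=
  tailProb M mt * (1 - 4 * Real.exp (-(mt * τ ^ 2 / 2))) * rrFactor α

lemma integral_voteKernel_bit (α τ : ℝ) (j : Fin (numBins τ)) :
    ∫ y, bit (y j) ∂(voteKernel α τ mt ∘ₘ dataLaw M μ) =
      1 / (1 + Real.exp (α / 6)) +
        rrFactor α * (dataLaw M μ).real {x | vote τ mt x j = true} := by
  have hi : Integrable (fun y : Fin (numBins τ) → Bool => bit (y j))
      (voteKernel α τ mt ∘ₘ dataLaw M μ) := Integrable.of_finite
  have hc := Kernel.integral_comp (η := voteKernel α τ mt) (κ := Kernel.const Unit (dataLaw M μ))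
    (a := ()) (f := fun y => bit (y j)) (by rwa [Kernel.comp_apply])
  rw [Kernel.comp_apply, Kernel.const_apply] at hc
  rw [hc]
  simp only [voteKernel_apply, integral_bit_randomizedResponse]
  have e : (fun x => bit (vote τ mt x j)) = {x | vote τ mt x j = true}.indicator 1 := by
    ext x
    by_cases hx : vote τ mt x j = true <;> simp [bit, hx]
  have hi2 : Integrable (fun x => bit (vote τ mt x j)) (dataLaw M μ) := by
    rw [e]
    exact (integrable_const 1).indicator (measurableSet_vote mt τ j)
  rw [integral_add (integrable_const _) (hi2.const_mul _), integral_const_mul, e,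
    integral_indicator_one (measurableSet_vote mt τ j)]
  simp

/-- Exponential moment of the difference of the privatised votes for a remote bin and for the bin
of the mean. -/
lemma lintegral_exp_bit_sub_le {α τ : ℝ} (hα : 0 ≤ α) (hτ : 0 < τ)
    (hs : 0 ≤ separation M mt α τ) {i j : Fin (numBins τ)} (hi : (i : ℕ) = binIndex τ (mean μ))
    (hj : ¬ IsNear τ (mean μ) j) :
    ∫⁻ x, ∫⁻ y, ENNReal.ofReal (Real.exp (separation M mt α τ * (bit (y j) - bit (y i))))
        ∂(voteKernel α τ mt x) ∂(dataLaw M μ) ≤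
      ENNReal.ofReal (Real.exp (-(separation M mt α τ ^ 2 / 2))) := by
  set D := separation M mt α τ with hD
  set κ := voteKernel α τ mt ∘ₘ dataLaw M μ with hκ
  have hmeas : ∀ f : (Fin (numBins τ) → Bool) → ℝ, Integrable f κ := fun f => Integrable.of_finite
  have hmean : ∫ y, (bit (y j) - bit (y i)) ∂κ ≤ -D := by
    rw [integral_sub (hmeas _) (hmeas _), hκ, integral_voteKernel_bit, integral_voteKernel_bit]
    have h1 := measureReal_vote_le M μ mt hτ hj
    have h2 := le_measureReal_vote M μ mt hτ i hi
    have h3 := rrFactor_nonneg hα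
    rw [hD, separation]
    nlinarith
  have hh := (hasSubgaussianMGF_of_mem_Icc (μ := κ)
    (X := fun y : Fin (numBins τ) → Bool => bit (y j) - bit (y i)) (a := -1) (b := 1)
    (measurable_of_countable _).aemeasurable (Filter.Eventually.of_forall fun y =>
      ⟨by linarith [bit_nonneg (y j), bit_le_one (y i)],
        by linarith [bit_nonneg (y i), bit_le_one (y j)]⟩)).mgf_le D
  set m := ∫ y, (bit (y j) - bit (y i)) ∂κ with hm
  have e1 : ∀ y : Fin (numBins τ) → Bool, Real.exp (D * (bit (y j) - bit (y i))) =
      Real.exp (D * m) * Real.exp (D * (bit (y j) - bit (y i) - m)) := fun y => by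
    rw [← Real.exp_add]
    ring_nf
  have h4 : ∫ y, Real.exp (D * (bit (y j) - bit (y i))) ∂κ ≤ Real.exp (-(D ^ 2 / 2)) := by
    simp only [e1]
    rw [integral_const_mul]
    refine (mul_le_mul_of_nonneg_left hh (Real.exp_pos _).le).trans ?_
    rw [← Real.exp_add, Real.exp_le_exp]
    have h5 : (((‖(1 : ℝ) - -1‖₊ / 2) ^ 2 : NNReal) : ℝ) = 1 := by norm_num
    rw [h5]
    nlinarith
  rw [← Measure.lintegral_bind (voteKernel α τ mt).aemeasurable
    (measurable_of_countable _).aemeasurable,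
    ← ofReal_integral_eq_lintegral_ofReal (hmeas _)
      (Filter.Eventually.of_forall fun y => (Real.exp_pos _).le)]
  exact ENNReal.ofReal_le_ofReal h4

end separation

/-! ### The elected bin -/

lemma argmaxIndex_spec {J : ℕ} (hJ : 0 < J) (c : Fin J → ℕ) :
    ∃ hj : argmaxIndex c < J, ∀ i, c i ≤ c ⟨argmaxIndex c, hj⟩ := by
  have : Nonempty (Fin J) := ⟨⟨0, hJ⟩⟩
  obtain ⟨j, hj⟩ := Finite.exists_max c
  exact Nat.sInf_mem (s := {j : ℕ | ∃ hj : j < J, ∀ i, c i ≤ c ⟨j, hj⟩}) ⟨j, j.2, hj⟩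

lemma electedBin_lt {J k : ℕ} (hJ : 0 < J) (h : ℕ) (z : Fin k → Msg J) : electedBin h z < J :=
  (argmaxIndex_spec hJ _).1

lemma electedBin_snoc {J k h : ℕ} (hk : h ≤ k) (z : Fin k → Msg J) (y : Msg J) :
    electedBin h (Fin.snoc (α := fun _ => Msg J) z y : Fin (k + 1) → Msg J) = electedBin h z := by
  unfold electedBin
  congr 1
  ext j
  simp only [tally, Fin.sum_univ_castSucc, Fin.snoc_castSucc, Fin.snoc_last, Fin.val_castSucc,
    Fin.val_last]
  simp [Nat.not_lt.2 hk]

lemma tally_eq_sum_bit {J k h : ℕ} (hk : k ≤ h) (z : Fin k → Msg J) (j : Fin J) :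
    (tally h z j : ℝ) = ∑ i, bit (msgVotes (z i) j) := by
  unfold tally bit
  push_cast
  refine Finset.sum_congr rfl fun i _ => ?_
  simp [lt_of_lt_of_le i.2 hk]

/-! ### The localisation phase -/

section phase

variable {c b : ℝ} {n : ℕ} {α : ℝ} {mt : ℕ+}

lemma channel_of_lt {k : ℕ} (hk : k < n) (h : k < n / 2) :
    (dameWith c b n α mt).channel ⟨k, hk⟩ = localisationChannel α (tau n α mt) mt k := if_pos h

lemma channel_of_le_of_lt {k : ℕ} (hk : k < n) (h : n / 2 ≤ k) (h' : k < 2 * (n / 2)) :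
    (dameWith c b n α mt).channel ⟨k, hk⟩ =
      estimationChannelWith c b α (tau n α mt) mt (n / 2) k :=
  (if_neg (not_lt.2 h)).trans (if_pos h')

lemma lintegral_prod_transcriptLaw (M : PMF ℕ+) (μ : Measure Obs) [IsProbabilityMeasure μ]
    {F : Msg (numBins (tau n α mt)) → ENNReal} (hF : Measurable F) (k : ℕ) (hk : k ≤ n)
    (hkh : k ≤ n / 2) :
    ∫⁻ z, ∏ i, F (z i) ∂((dameWith c b n α mt).transcriptLaw (dataLaw M μ) k hk) =
      (∫⁻ x, ∫⁻ y, F (Sum.inl y) ∂(voteKernel α (tau n α mt) mt x) ∂(dataLaw M μ)) ^ k := by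
  have hm : ∀ k : ℕ, Measurable fun z : Fin k → Msg (numBins (tau n α mt)) => ∏ i, F (z i) :=
    fun k => Finset.measurable_fun_prod _ fun i _ => hF.comp (measurable_pi_apply i)
  induction k with
  | zero =>
    rw [Mechanism.lintegral_transcriptLaw_zero _ _ (hm 0)]
    simp
  | succ k ih =>
    rw [Mechanism.lintegral_transcriptLaw_succ _ _ _ hk (hm _), channel_of_lt hk hkh]
    simp only [Fin.prod_univ_castSucc, Fin.snoc_castSucc, Fin.snoc_last]
    have h1 : ∀ (z : Fin k → Msg (numBins (tau n α mt))) (x : Dataset),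
        ∫⁻ y, (∏ i, F (z i)) * F y ∂(localisationChannel α (tau n α mt) mt k (x, z)) =
          (∏ i, F (z i)) * ∫⁻ y, F (Sum.inl y) ∂(voteKernel α (tau n α mt) mt x) := fun z x => by
      rw [lintegral_const_mul _ hF, lintegral_localisationChannel _ _ _ _ _ hF]
    have hv : Measurable fun x => ∫⁻ y, F (Sum.inl y) ∂(voteKernel α (tau n α mt) mt x) :=
      (hF.comp measurable_inl).lintegral_kernel
    simp only [h1]
    simp_rw [lintegral_const_mul _ hv]
    rw [lintegral_mul_const _ (hm k), ih (Nat.le_of_succ_le hk) (Nat.le_of_succ_le hkh), pow_succ]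

lemma lintegral_electedBin_eq {J : ℕ} (Q : Mechanism n Dataset (Msg J)) (ν : Measure Dataset)
    [IsProbabilityMeasure ν] (g : ℕ → ENNReal) {h k : ℕ} (hhk : h ≤ k) (hk : k ≤ n) :
    ∫⁻ z, g (electedBin h z) ∂(Q.transcriptLaw ν k hk) =
      ∫⁻ z, g (electedBin h z) ∂(Q.transcriptLaw ν h (hhk.trans hk)) := by
  induction k, hhk using Nat.le_induction with
  | base => rfl
  | succ k hhk ih =>
    have := Q.markov ⟨k, hk⟩
    have hm : Measurable fun z : Fin (k + 1) → Msg J => g (electedBin h z) :=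
      (measurable_of_countable g).comp (measurable_electedBin h)
    rw [Mechanism.lintegral_transcriptLaw_succ _ _ _ hk hm, ← ih (Nat.le_of_succ_le hk)]
    simp only [electedBin_snoc hhk, lintegral_const, measure_univ, mul_one]

open Classical in
/-- The probability that the localisation phase elects a remote bin. -/
lemma lintegral_not_isNear_le (M : PMF ℕ+) (μ : Measure Obs) [IsProbabilityMeasure μ]
    (hα : 0 ≤ α) (hs : 0 ≤ separation M mt α (tau n α mt)) (k : ℕ) (hhk : n / 2 ≤ k) (hk : k ≤ n) :
    ∫⁻ z, (if IsNear (tau n α mt) (mean μ) (electedBin (n / 2) z) then 0 else 1)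
        ∂((dameWith c b n α mt).transcriptLaw (dataLaw M μ) k hk) ≤
      ENNReal.ofReal (((numBins (tau n α mt) : ℝ) - 1) *
        Real.exp (-((n / 2 : ℕ) * separation M mt α (tau n α mt) ^ 2 / 2))) := by
  rw [lintegral_electedBin_eq _ _
    (fun j => if IsNear (tau n α mt) (mean μ) j then 0 else 1) hhk hk]
  set τ := tau n α mt with hτe
  set D := separation M mt α τ with hD
  have hτ : 0 < τ := tau_pos n α mt
  have hJ := numBins_pos hτ
  let j₀ : Fin (numBins τ) := ⟨binIndex τ (mean μ), binIndex_lt hτ _⟩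
  let F : Fin (numBins τ) → Msg (numBins τ) → ENNReal := fun j y =>
    ENNReal.ofReal (Real.exp (D * (bit (msgVotes y j) - bit (msgVotes y j₀))))
  have hF : ∀ j, Measurable (F j) := fun j =>
    (measurable_of_countable fun v : Fin (numBins τ) → Bool =>
      ENNReal.ofReal (Real.exp (D * (bit (v j) - bit (v j₀))))).comp measurable_msgVotes
  let A : Finset (Fin (numBins τ)) := Finset.univ.filter fun j => ¬ IsNear τ (mean μ) j
  have hA : (A.card : ℝ) ≤ (numBins τ : ℝ) - 1 := by
    have h1 : A ⊆ Finset.univ.erase j₀ := fun j hj => by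
      refine Finset.mem_erase.2 ⟨fun h => ?_, Finset.mem_univ _⟩
      rw [h] at hj
      exact (Finset.mem_filter.1 hj).2 ⟨j₀.2, Nat.le_add_right _ 2, Nat.le_add_right _ 2⟩
    have h2 := Finset.card_le_card h1
    rw [Finset.card_erase_of_mem (Finset.mem_univ _), Finset.card_univ, Fintype.card_fin] at h2
    have h3 : (A.card : ℝ) ≤ (numBins τ - 1 : ℕ) := by exact_mod_cast h2
    rwa [Nat.cast_sub hJ, Nat.cast_one] at h3
  have hpt : ∀ z : Fin (n / 2) → Msg (numBins τ),
      (if IsNear τ (mean μ) (electedBin (n / 2) z) then 0 else 1 : ENNReal) ≤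
        ∑ j ∈ A, ∏ i, F j (z i) := fun z => by
    split_ifs with hz
    · exact zero_le
    · obtain ⟨hj, hmax⟩ := argmaxIndex_spec hJ (tally (n / 2) z)
      have hmem : (⟨_, hj⟩ : Fin (numBins τ)) ∈ A :=
        Finset.mem_filter.2 ⟨Finset.mem_univ _, hz⟩
      refine le_trans ?_ (Finset.single_le_sum (f := fun j => ∏ i, F j (z i))
        (fun _ _ => zero_le) hmem)
      have h1 : ((tally (n / 2) z j₀ : ℕ) : ℝ) ≤ tally (n / 2) z ⟨_, hj⟩ :=
        Nat.cast_le.2 (hmax j₀)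
      rw [tally_eq_sum_bit le_rfl, tally_eq_sum_bit le_rfl] at h1
      simp only [F]
      rw [← ENNReal.ofReal_prod_of_nonneg fun _ _ => (Real.exp_pos _).le, ← Real.exp_sum,
        ← Finset.mul_sum, Finset.sum_sub_distrib, ← ENNReal.ofReal_one]
      exact ENNReal.ofReal_le_ofReal (Real.one_le_exp (mul_nonneg hs (sub_nonneg.2 h1)))
  refine (lintegral_mono hpt).trans ?_
  have hm : ∀ j, Measurable fun z : Fin (n / 2) → Msg (numBins τ) => ∏ i, F j (z i) := fun j =>
    Finset.measurable_fun_prod _ fun i _ => (hF j).comp (measurable_pi_apply i)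
  rw [lintegral_finsetSum _ fun j _ => hm j]
  calc _ ≤ ∑ _j ∈ A, ENNReal.ofReal (Real.exp (-(D ^ 2 / 2))) ^ (n / 2) := by
        refine Finset.sum_le_sum fun j hj => ?_
        rw [lintegral_prod_transcriptLaw M μ (hF j) _ _ le_rfl]
        gcongr
        exact lintegral_exp_bit_sub_le M μ mt hα hτ hs rfl (Finset.mem_filter.1 hj).2
    _ = ENNReal.ofReal (A.card * Real.exp (-((n / 2 : ℕ) * D ^ 2 / 2))) := by
        rw [Finset.sum_const, nsmul_eq_mul, ← ENNReal.ofReal_pow (Real.exp_pos _).le,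
          ← Real.exp_nat_mul, ENNReal.ofReal_mul (Nat.cast_nonneg _), ENNReal.ofReal_natCast]
        congr 3
        ring
    _ ≤ _ := by gcongr

end phase

/-! ### Moments of Laplace noise -/

lemma integral_sq_mul_exp_neg_abs : ∫ y : ℝ, y ^ 2 * Real.exp (-|y|) = 4 := by
  have h := integral_comp_abs (f := fun y : ℝ => y ^ 2 * Real.exp (-y))
  simp only [sq_abs] at h
  rw [h]
  have h2 := Real.Gamma_eq_integral (s := 3) (by norm_num)
  have h3 : Real.Gamma 3 = 2 := by
    rw [show (3 : ℝ) = (2 : ℕ) + 1 by norm_num, Real.Gamma_nat_eq_factorial]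
    norm_num [Nat.factorial]
  rw [h3] at h2
  have h4 : ∫ y in Set.Ioi (0 : ℝ), y ^ 2 * Real.exp (-y) = 2 := by
    rw [h2]
    refine setIntegral_congr_fun measurableSet_Ioi fun y _ => ?_
    norm_num
    ring
  rw [h4]
  norm_num

lemma integrable_sq_mul_exp_neg_abs : Integrable fun y : ℝ => y ^ 2 * Real.exp (-|y|) := by
  by_contra hn
  have h := integral_sq_mul_exp_neg_abs
  rw [integral_undef hn] at h
  norm_num at h

lemma laplace_eq : laplace = volume.withDensity
    fun y => ENNReal.ofReal (Real.exp (-|y|) / 2) := rfl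

lemma integral_laplace (f : ℝ → ℝ) :
    ∫ y, f y ∂laplace = ∫ y, Real.exp (-|y|) / 2 * f y := by
  rw [laplace_eq, integral_withDensity_eq_integral_toReal_smul (by fun_prop)
    (Filter.Eventually.of_forall fun y => ENNReal.ofReal_lt_top)]
  refine integral_congr_ae (Filter.Eventually.of_forall fun y => ?_)
  simp only [smul_eq_mul]
  rw [ENNReal.toReal_ofReal (by positivity)]

lemma integrable_sq_laplace : Integrable (fun y : ℝ => y ^ 2) laplace := by
  rw [laplace_eq, integrable_withDensity_iff_integrable_smul' (by fun_prop)
    (Filter.Eventually.of_forall fun y => ENNReal.ofReal_lt_top)]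
  refine (integrable_sq_mul_exp_neg_abs.div_const 2).congr
    (Filter.Eventually.of_forall fun y => ?_)
  simp only [smul_eq_mul]
  rw [ENNReal.toReal_ofReal (by positivity)]
  ring

lemma integrable_id_laplace : Integrable (fun y : ℝ => y) laplace := by
  refine ((integrable_const (1 : ℝ)).add integrable_sq_laplace).mono'
    measurable_id.aestronglyMeasurable (Filter.Eventually.of_forall fun y => ?_)
  rw [Real.norm_eq_abs, Pi.add_apply]
  nlinarith [sq_nonneg (|y| - 1), sq_abs y]

lemma integral_sq_laplace : ∫ y, y ^ 2 ∂laplace = 2 := by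
  rw [integral_laplace]
  calc _ = ∫ y : ℝ, y ^ 2 * Real.exp (-|y|) / 2 :=
        integral_congr_ae (Filter.Eventually.of_forall fun y => by ring)
    _ = 2 := by
        rw [integral_div, integral_sq_mul_exp_neg_abs]
        norm_num

lemma integral_id_laplace : ∫ y, y ∂laplace = 0 := by
  rw [integral_laplace]
  have h := integral_neg_eq_self (fun y : ℝ => Real.exp (-|y|) / 2 * y) volume
  simp only [abs_neg, mul_neg] at h
  rw [integral_neg] at h
  linarith

lemma lintegral_sq_laplace (a s : ℝ) :
    ∫⁻ y, ENNReal.ofReal ((a + s * y) ^ 2) ∂laplace = ENNReal.ofReal (a ^ 2 + 2 * s ^ 2) := by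
  have e : ∀ y : ℝ, (a + s * y) ^ 2 = a ^ 2 + (2 * a * s * y + s ^ 2 * y ^ 2) := fun y => by ring
  have hi1 := integrable_id_laplace.const_mul (2 * a * s)
  have hi2 := integrable_sq_laplace.const_mul (s ^ 2)
  have hi3 : Integrable (fun y : ℝ => 2 * a * s * y + s ^ 2 * y ^ 2) laplace := hi1.add hi2
  have hi4 : Integrable (fun y : ℝ => a ^ 2 + (2 * a * s * y + s ^ 2 * y ^ 2)) laplace :=
    (integrable_const _).add hi3
  simp only [e]
  rw [← ofReal_integral_eq_lintegral_ofReal hi4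
    (Filter.Eventually.of_forall fun y => (sq_nonneg (a + s * y)).trans_eq (e y))]
  rw [integral_add (integrable_const _) hi3, integral_add hi1 hi2, integral_const_mul,
    integral_const_mul, integral_id_laplace, integral_sq_laplace]
  simp only [integral_const, probReal_univ, smul_eq_mul]
  ring_nf

/-! ### The estimation phase -/

section estimation

variable {c b : ℝ} {n : ℕ} {α : ℝ} {mt : ℕ+}

/-- The projected shrunk mean of a user. -/
def userEstimate (c τ : ℝ) (mt : ℕ+) (j : ℕ) (x : Dataset) : ℝ :=
  projectWith c τ j (shrunkMean τ mt j x)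

lemma measurable_userEstimate (c τ : ℝ) (mt : ℕ+) (j : ℕ) : Measurable (userEstimate c τ mt j) :=
  (measurable_projectWith c τ j).comp (measurable_shrunkMean τ mt j)

/-- Second moment of a message of the estimation phase about the true mean. -/
def noiseLevel (b α τ : ℝ) (mt : ℕ+) : ℝ :=
  6.5 / mt + 31.25 * τ ^ 2 + 2 * (b * τ / α) ^ 2

lemma noiseLevel_nonneg (b α τ : ℝ) (mt : ℕ+) : 0 ≤ noiseLevel b α τ mt := by
  have h2 : (0 : ℝ) < mt := by exact_mod_cast mt.pos
  unfold noiseLevel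
  positivity

variable (M : PMF ℕ+) (μ : Measure Obs) [IsProbabilityMeasure μ]

lemma abs_userEstimate_le {τ : ℝ} (hτ : 0 < τ) (hc : 5 ≤ c) {j : ℕ}
    (hj : IsNear τ (mean μ) j) (x : Dataset) :
    |userEstimate c τ mt j x| ≤ 3 + 5 * τ := by
  have h1 := abs_projectWith_shrunkMean_sub_le hτ hc (abs_mean_le μ) mt hj x
  have h2 := abs_dev_le mt (abs_mean_le μ) x
  have h3 := abs_mean_le μ
  have h4 := abs_sub_abs_le_abs_sub (userEstimate c τ mt j x) (mean μ)
  unfold userEstimate at *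
  linarith

lemma integral_userEstimate_sub_sq_le {τ : ℝ} (hτ : 0 < τ) (hc : 5 ≤ c) {j : ℕ}
    (hj : IsNear τ (mean μ) j) :
    ∫ x, (userEstimate c τ mt j x - mean μ) ^ 2 ∂(dataLaw M μ) ≤
      6.5 / mt + 31.25 * τ ^ 2 := by
  have hθ := abs_mean_le μ
  have hi : Integrable (fun x => 5 * dev mt (mean μ) x ^ 2) (dataLaw M μ) := by
    refine (integrable_of_abs_le M μ ((measurable_dev mt (mean μ)).pow_const 2) 4
      fun x => ?_).const_mul 5
    rw [abs_pow]
    nlinarith [abs_dev_le mt hθ x, abs_nonneg (dev mt (mean μ) x)]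
  calc _ ≤ ∫ x, (5 * dev mt (mean μ) x ^ 2 + 31.25 * τ ^ 2) ∂(dataLaw M μ) := by
        refine integral_mono_of_nonneg (Filter.Eventually.of_forall fun x => sq_nonneg _)
          (hi.add (integrable_const _)) (Filter.Eventually.of_forall fun x => ?_)
        have h1 := abs_projectWith_shrunkMean_sub_le hτ hc hθ mt hj x
        simp only [userEstimate]
        rw [← sq_abs, ← sq_abs (dev mt (mean μ) x)]
        have h2 := pow_le_pow_left₀ (abs_nonneg _) h1 2
        nlinarith [sq_nonneg (2 * |dev mt (mean μ) x| - 2.5 * τ)]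
    _ = 5 * ∫ x, dev mt (mean μ) x ^ 2 ∂(dataLaw M μ) + 31.25 * τ ^ 2 := by
        rw [integral_add hi (integrable_const _), integral_const_mul]
        simp
    _ ≤ 5 * (1.3 / mt) + 31.25 * τ ^ 2 := by
        gcongr
        exact integral_dev_sq_le M μ mt
    _ = _ := by ring

/-- The centred square of a bounded variable plus a constant. -/
lemma lintegral_add_centred_sq_le {f : Dataset → ℝ} (hf : Measurable f) (B : ℝ)
    (hB : ∀ x, |f x| ≤ B) (a t v : ℝ) (hv : 0 ≤ v) :
    ∫⁻ x, ENNReal.ofReal ((a + (f x - ∫ x, f x ∂(dataLaw M μ))) ^ 2 + v) ∂(dataLaw M μ) ≤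
      ENNReal.ofReal (a ^ 2 + ∫ x, (f x - t) ^ 2 ∂(dataLaw M μ) + v) := by
  set m := ∫ x, f x ∂(dataLaw M μ) with hm
  have hi := integrable_of_abs_le M μ hf B hB
  have hi2 : Integrable (fun x => (f x - t) ^ 2) (dataLaw M μ) := by
    refine integrable_of_abs_le M μ ((hf.sub_const t).pow_const 2) ((B + |t|) ^ 2) fun x => ?_
    rw [abs_pow]
    refine pow_le_pow_left₀ (abs_nonneg _) ((abs_sub _ _).trans ?_) 2
    linarith [hB x]
  have e : ∀ x, (a + (f x - m)) ^ 2 + v =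
      (f x - t) ^ 2 + (2 * (a + t - m) * f x + ((a - m) ^ 2 - t ^ 2 + v)) := fun x => by ring
  have hi3 : Integrable (fun x => 2 * (a + t - m) * f x) (dataLaw M μ) := hi.const_mul _
  have hi4 : Integrable (fun x => 2 * (a + t - m) * f x + ((a - m) ^ 2 - t ^ 2 + v))
      (dataLaw M μ) := hi3.add (integrable_const _)
  have hi5 : Integrable (fun x => (f x - t) ^ 2 +
      (2 * (a + t - m) * f x + ((a - m) ^ 2 - t ^ 2 + v))) (dataLaw M μ) := hi2.add hi4
  simp only [e]
  rw [← ofReal_integral_eq_lintegral_ofReal hi5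
    (Filter.Eventually.of_forall fun x => (by positivity : 0 ≤ (a + (f x - m)) ^ 2 + v).trans_eq
      (e x))]
  refine ENNReal.ofReal_le_ofReal ?_
  rw [integral_add hi2 hi4, integral_add hi3 (integrable_const _), integral_const_mul, ← hm]
  simp only [integral_const, probReal_univ, smul_eq_mul]
  nlinarith [sq_nonneg (m - t)]

/-- One step of the estimation phase: the messages are centred and have bounded variance. -/
lemma lintegral_estimation_step_le {τ : ℝ} (hτ : 0 < τ) (hc : 5 ≤ c) {j : ℕ}
    (hj : IsNear τ (mean μ) j) (a : ℝ) :
    ∫⁻ x, ∫⁻ y, ENNReal.ofReal ((a + (userEstimate c τ mt j x + b * τ / α * y -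
        ∫ x, userEstimate c τ mt j x ∂(dataLaw M μ))) ^ 2) ∂laplace ∂(dataLaw M μ) ≤
      ENNReal.ofReal (a ^ 2 + noiseLevel b α τ mt) := by
  have e : ∀ x y, a + (userEstimate c τ mt j x + b * τ / α * y -
        ∫ x, userEstimate c τ mt j x ∂(dataLaw M μ)) =
      (a + (userEstimate c τ mt j x - ∫ x, userEstimate c τ mt j x ∂(dataLaw M μ))) +
        b * τ / α * y := fun x y => by ring
  simp only [e, lintegral_sq_laplace]
  refine (lintegral_add_centred_sq_le M μ (measurable_userEstimate c τ mt j) _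
    (abs_userEstimate_le μ hτ hc hj) a (mean μ) _ (by positivity)).trans
    (ENNReal.ofReal_le_ofReal ?_)
  unfold noiseLevel
  linarith [integral_userEstimate_sub_sq_le (mt := mt) M μ hτ hc hj]

/-- Sum of the centred messages of the estimation phase. -/
def centredSum (n : ℕ) {J k : ℕ} (m : ℝ) (z : Fin k → Msg J) : ℝ :=
  ∑ i : Fin k, if n / 2 ≤ (i : ℕ) ∧ (i : ℕ) < 2 * (n / 2) then msgReal (z i) - m else 0

lemma measurable_centredSum {J k : ℕ} (m : ℝ) :
    Measurable fun z : Fin k → Msg J => centredSum n m z := by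
  refine Finset.measurable_fun_sum _ fun i _ => ?_
  split_ifs
  · exact (measurable_msgReal.comp (measurable_pi_apply i)).sub_const m
  · exact measurable_const

lemma centredSum_snoc {J k : ℕ} (m : ℝ) (z : Fin k → Msg J) (y : Msg J) :
    centredSum n m (Fin.snoc (α := fun _ => Msg J) z y : Fin (k + 1) → Msg J) =
      centredSum n m z + if n / 2 ≤ k ∧ k < 2 * (n / 2) then msgReal y - m else 0 := by
  simp [centredSum, Fin.sum_univ_castSucc]

open Classical in
lemma lintegral_centredSum_le (hc : 5 ≤ c) (a₀ : ℕ → ℝ) (β : ℝ)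
    (hβ : ∀ j, IsNear (tau n α mt) (mean μ) j → |a₀ j| ≤ β) (k : ℕ) (hhk : n / 2 ≤ k)
    (hk : k ≤ n) :
    ∫⁻ z, (if IsNear (tau n α mt) (mean μ) (electedBin (n / 2) z) then
        ENNReal.ofReal ((a₀ (electedBin (n / 2) z) + centredSum n
          (∫ x, userEstimate c (tau n α mt) mt (electedBin (n / 2) z) x ∂(dataLaw M μ)) z) ^ 2)
        else 0) ∂((dameWith c b n α mt).transcriptLaw (dataLaw M μ) k hk) ≤
      ENNReal.ofReal (β ^ 2 +
        ((min k (2 * (n / 2)) - n / 2 : ℕ) : ℝ) * noiseLevel b α (tau n α mt) mt) := by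
  set τ := tau n α mt with hτe
  have hτ : 0 < τ := tau_pos n α mt
  have hV := noiseLevel_nonneg b α τ mt
  have hsq : ∀ j, IsNear τ (mean μ) j → a₀ j ^ 2 ≤ β ^ 2 := fun j hj => by
    rw [← sq_abs]
    exact pow_le_pow_left₀ (abs_nonneg _) (hβ j hj) 2
  set m : ℕ → ℝ := fun j => ∫ x, userEstimate c τ mt j x ∂(dataLaw M μ) with hm
  let Φ : (k : ℕ) → ℕ → (Fin k → Msg (numBins τ)) → ENNReal := fun k j z =>
    if IsNear τ (mean μ) j then ENNReal.ofReal ((a₀ j + centredSum n (m j) z) ^ 2) else 0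
  have hΦ : ∀ k, Measurable fun z : Fin k → Msg (numBins τ) => Φ k (electedBin (n / 2) z) z := by
    intro k
    have h1 : Measurable fun q : ℕ × (Fin k → Msg (numBins τ)) => Φ k q.1 q.2 := by
      refine measurable_from_prod_countable_right fun j => ?_
      by_cases hj : IsNear τ (mean μ) j
      · simp only [Φ, hj, if_true]
        exact (((measurable_centredSum (m j)).const_add _).pow_const 2).ennreal_ofReal
      · simp only [Φ, hj, if_false]
        exact measurable_const
    exact h1.comp ((measurable_electedBin (n / 2)).prodMk measurable_id)
  change ∫⁻ z, Φ k (electedBin (n / 2) z) z ∂_ ≤ _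
  induction k, hhk using Nat.le_induction with
  | base =>
    have := (dameWith c b n α mt).isProbabilityMeasure_transcriptLaw (dataLaw M μ) (n / 2) hk
    have h0 : ∀ z : Fin (n / 2) → Msg (numBins τ), Φ (n / 2) (electedBin (n / 2) z) z ≤
        ENNReal.ofReal (β ^ 2) := fun z => by
      have hS : ∀ m', centredSum n m' z = 0 := fun m' => Finset.sum_eq_zero fun i _ =>
        if_neg fun h => absurd i.2 (not_lt.2 h.1)
      simp only [Φ, hS, add_zero]
      split_ifs with hz
      · exact ENNReal.ofReal_le_ofReal (hsq _ hz)
      · exact zero_le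
    refine (lintegral_mono h0).trans ?_
    rw [lintegral_const, measure_univ, mul_one]
    refine ENNReal.ofReal_le_ofReal ?_
    have : (0 : ℝ) ≤ ((min (n / 2) (2 * (n / 2)) - n / 2 : ℕ) : ℝ) := Nat.cast_nonneg _
    nlinarith
  | succ k hhk ih =>
    specialize ih (Nat.le_of_succ_le hk)
    have hprob := (dameWith c b n α mt).isProbabilityMeasure_transcriptLaw (dataLaw M μ) k
      (Nat.le_of_succ_le hk)
    have hmk := (dameWith c b n α mt).markov ⟨k, hk⟩
    rw [Mechanism.lintegral_transcriptLaw_succ _ _ _ hk (hΦ (k + 1))]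
    simp only [electedBin_snoc hhk]
    by_cases hk2 : k < 2 * (n / 2)
    · have hcount : ((min (k + 1) (2 * (n / 2)) - n / 2 : ℕ) : ℝ) =
          ((min k (2 * (n / 2)) - n / 2 : ℕ) : ℝ) + 1 := by
        have : min (k + 1) (2 * (n / 2)) - n / 2 = (min k (2 * (n / 2)) - n / 2) + 1 := by omega
        rw [this]
        push_cast
        ring
      have hstep : ∀ z : Fin k → Msg (numBins τ), ∫⁻ x, ∫⁻ y, Φ (k + 1) (electedBin (n / 2) z)
            (Fin.snoc (α := fun _ => Msg (numBins τ)) z y)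
            ∂((dameWith c b n α mt).channel ⟨k, hk⟩ (x, z)) ∂(dataLaw M μ) ≤
          Φ k (electedBin (n / 2) z) z + ENNReal.ofReal (noiseLevel b α τ mt) := fun z => by
        rw [channel_of_le_of_lt hk hhk hk2]
        set j := electedBin (n / 2) z with hj
        by_cases hnear : IsNear τ (mean μ) j
        · have hmy : Measurable fun y : Msg (numBins τ) => ENNReal.ofReal
              ((a₀ j + (centredSum n (m j) z + (msgReal y - m j))) ^ 2) := by
            have := measurable_msgReal (J := numBins τ)
            fun_prop
          simp only [Φ, hnear, if_true, centredSum_snoc, hhk, hk2, and_self]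
          rw [← ENNReal.ofReal_add (sq_nonneg _) hV]
          refine le_trans (le_of_eq (lintegral_congr fun x => ?_))
            (lintegral_estimation_step_le (b := b) (α := α) (mt := mt) M μ hτ hc hnear
              (a₀ j + centredSum n (m j) z))
          rw [lintegral_estimationChannelWith _ _ _ _ _ _ _ _ hmy]
          refine lintegral_congr fun y => ?_
          simp only [msgReal, Sum.elim_inr, id, localEstimateWith, userEstimate, ← hj, add_assoc]
          rfl
        · simp [Φ, hnear]
      refine (lintegral_mono hstep).trans ?_
      rw [lintegral_add_right _ measurable_const, lintegral_const, measure_univ, mul_one, hcount]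
      refine (add_le_add ih le_rfl).trans ?_
      rw [← ENNReal.ofReal_add (by positivity) hV]
      exact ENNReal.ofReal_le_ofReal (by linarith)
    · have hcount : min (k + 1) (2 * (n / 2)) - n / 2 = min k (2 * (n / 2)) - n / 2 := by omega
      rw [hcount]
      refine le_trans (le_of_eq (lintegral_congr fun z => ?_)) ih
      have hsn : ∀ y : Msg (numBins τ), Φ (k + 1) (electedBin (n / 2) z)
          (Fin.snoc (α := fun _ => Msg (numBins τ)) z y) = Φ k (electedBin (n / 2) z) z :=
        fun y => by simp [Φ, centredSum_snoc, hk2]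
      simp only [hsn, lintegral_const, measure_univ, mul_one]

/-! ### Bias -/

lemma hasSum_sqrtMean : HasSum (fun k : ℕ+ => (M k).toReal * √((min k mt : ℕ+) : ℝ))
    (sqrtMean M mt) := by
  refine Summable.hasSum (Summable.of_nonneg_of_le (fun k => by positivity) (fun k => ?_)
    ((hasSum_toReal M).summable.mul_right √(mt : ℝ)))
  have h : ((min k mt : ℕ+) : ℝ) ≤ (mt : ℝ) := by
    exact_mod_cast PNat.coe_le_coe _ _ |>.2 (min_le_right k mt)
  gcongr

lemma sqrtMean_le : sqrtMean M mt ≤ √(mt : ℝ) := by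
  refine hasSum_le (fun k => ?_) (hasSum_sqrtMean M) (by
    simpa using (hasSum_toReal M).mul_right √(mt : ℝ))
  have h : ((min k mt : ℕ+) : ℝ) ≤ (mt : ℝ) := by
    exact_mod_cast PNat.coe_le_coe _ _ |>.2 (min_le_right k mt)
  gcongr

lemma one_le_sqrtMean : 1 ≤ sqrtMean M mt := by
  refine hasSum_le (fun k => ?_) (hasSum_toReal M) (hasSum_sqrtMean M)
  have h : (1 : ℝ) ≤ ((min k mt : ℕ+) : ℝ) := by exact_mod_cast (one_le : 1 ≤ min k mt)
  exact le_mul_of_one_le_right ENNReal.toReal_nonneg (Real.one_le_sqrt.2 h)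

lemma sum_sqrt_sub : ∑ i ∈ Finset.Icc 1 mt, (√(mt : ℝ) - √(i : ℝ)) * (M i).toReal =
    √(mt : ℝ) - sqrtMean M mt := by
  have h1 : HasSum (fun k : ℕ+ => (M k).toReal * √(mt : ℝ) -
      (M k).toReal * √((min k mt : ℕ+) : ℝ)) (1 * √(mt : ℝ) - sqrtMean M mt) :=
    ((hasSum_toReal M).mul_right _).sub (hasSum_sqrtMean M)
  rw [one_mul] at h1
  refine HasSum.unique ?_ h1
  have h2 : HasSum (fun k : ℕ+ => (M k).toReal * √(mt : ℝ) -
      (M k).toReal * √((min k mt : ℕ+) : ℝ)) (∑ k ∈ Finset.Icc 1 mt,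
        ((M k).toReal * √(mt : ℝ) - (M k).toReal * √((min k mt : ℕ+) : ℝ))) :=
    hasSum_sum_of_ne_finset_zero fun k hk => by
      have : ¬ k ≤ mt := fun h => hk (Finset.mem_Icc.2 ⟨one_le, h⟩)
      rw [min_eq_right (le_of_not_ge this), sub_self]
  convert h2 using 1
  refine Finset.sum_congr rfl fun k hk => ?_
  rw [min_eq_left (Finset.mem_Icc.1 hk).2]
  ring

lemma integral_shrunkMean {τ : ℝ} (hτ : 0 < τ) {j : ℕ} (hj : j < numBins τ) :
    ∫ x, shrunkMean τ mt j x ∂(dataLaw M μ) =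
      sqrtMean M mt / √(mt : ℝ) * mean μ + (1 - sqrtMean M mt / √(mt : ℝ)) * binCenter τ j := by
  have h0 := hasSum_integral_dataLaw M μ (measurable_shrunkMean τ mt j) 1
    (abs_shrunkMean_le hτ mt hj)
  have e : ∀ k : ℕ+, (M k).toReal *
      ∫ x, shrunkMean τ mt j ⟨k, x⟩ ∂(Measure.pi fun _ : Fin (k : ℕ) => μ) =
      (M k).toReal * √((min k mt : ℕ+) : ℝ) / √(mt : ℝ) * (mean μ - binCenter τ j) +
        (M k).toReal * binCenter τ j := fun k => by
    have hi : Integrable (fun x => sampleMean ⟨k, x⟩) (Measure.pi fun _ : Fin (k : ℕ) => μ) :=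
      Integrable.of_bound (measurable_sampleMean.comp (measurable_sigmaMk k)).aestronglyMeasurable 1
        (Filter.Eventually.of_forall fun x => abs_sampleMean_le _)
    simp only [shrunkMean_eq]
    rw [integral_add (hi.const_mul _) (integrable_const _), integral_const_mul,
      integral_sampleMean]
    have hw : weight mt k = √((min k mt : ℕ+) : ℝ) / √(mt : ℝ) := rfl
    simp only [integral_const, probReal_univ, smul_eq_mul, hw]
    ring
  simp only [e] at h0
  have h1 := ((hasSum_sqrtMean (mt := mt) M).div_const √(mt : ℝ)).mul_right
    (mean μ - binCenter τ j)
  rw [h0.unique (h1.add ((hasSum_toReal M).mul_right (binCenter τ j)))]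
  ring

lemma abs_integral_userEstimate_sub_le {τ : ℝ} (hτ : 0 < τ) (hc : 5 ≤ c) {j : ℕ}
    (hj : IsNear τ (mean μ) j) :
    |∫ x, userEstimate c τ mt j x ∂(dataLaw M μ) - ∫ x, shrunkMean τ mt j x ∂(dataLaw M μ)| ≤
      2 * Real.exp (-(mt * τ ^ 2 / 2)) / (mt * τ) := by
  have h1 := integrable_of_abs_le M μ (measurable_userEstimate c τ mt j) _
    (abs_userEstimate_le μ hτ hc hj)
  have h2 := integrable_of_abs_le M μ (measurable_shrunkMean τ mt j) _
    (abs_shrunkMean_le hτ mt hj.1)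
  rw [← integral_sub h1 h2]
  refine (abs_integral_le_integral_abs).trans (le_trans ?_ (integral_excess_le M μ mt hτ))
  have h3 : Integrable (fun x => max (|dev mt (mean μ) x| - τ) 0) (dataLaw M μ) := by
    refine integrable_of_abs_le M μ (((measurable_dev mt _).abs.sub_const τ).max measurable_const)
      2 fun x => ?_
    rw [abs_of_nonneg (le_max_right _ _)]
    exact max_le (by linarith [abs_dev_le mt (abs_mean_le μ) x]) (by norm_num)
  exact integral_mono_of_nonneg (Filter.Eventually.of_forall fun x => abs_nonneg _) h3
    (Filter.Eventually.of_forall fun x =>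
      abs_projectWith_shrunkMean_sub_self_le hτ hc (abs_mean_le μ) mt hj x)

end estimation

/-! ### The risk of DAME -/

section risk

lemma sum_ite_half (n : ℕ) (f : Fin n → ℝ) (m : ℝ) :
    ∑ i : Fin n, (if n / 2 ≤ (i : ℕ) ∧ (i : ℕ) < 2 * (n / 2) then f i - m else 0) =
      (∑ i : Fin n, if n / 2 ≤ (i : ℕ) ∧ (i : ℕ) < 2 * (n / 2) then f i else 0) -
        (n / 2 : ℕ) * m := by
  have h1 : ∑ i : Fin n, (if n / 2 ≤ (i : ℕ) ∧ (i : ℕ) < 2 * (n / 2) then m else 0) =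
      (n / 2 : ℕ) * m := by
    rw [Fin.sum_univ_eq_sum_range
      (fun i => if n / 2 ≤ i ∧ i < 2 * (n / 2) then m else 0) n, ← Finset.sum_filter]
    have h2 : (Finset.range n).filter (fun i => n / 2 ≤ i ∧ i < 2 * (n / 2)) =
        Finset.Ico (n / 2) (2 * (n / 2)) := by
      ext i
      simp only [Finset.mem_filter, Finset.mem_range, Finset.mem_Ico]
      omega
    rw [h2, Finset.sum_const, Nat.card_Ico, nsmul_eq_mul]
    congr 2
    omega
  rw [← h1, ← Finset.sum_sub_distrib]
  refine Finset.sum_congr rfl fun i _ => ?_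
  split_ifs <;> simp

variable {c b : ℝ} {n : ℕ} {α : ℝ} {mt : ℕ+} (M : PMF ℕ+)

lemma measurable_averageEstimate {J : ℕ} : Measurable (averageEstimate (n := n) (J := J)) := by
  refine (Finset.measurable_fun_sum _ fun i _ => ?_).div_const _
  split_ifs
  · exact measurable_msgReal.comp (measurable_pi_apply i)
  · exact measurable_const

lemma measurable_dameEstimator : Measurable (dameEstimator n α M mt) := by
  refine continuous_projIcc.measurable.comp ?_
  have h1 : Measurable fun z : Fin n → Msg (numBins (tau n α mt)) =>
      binCenter (tau n α mt) (electedBin (n / 2) z) :=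
    (measurable_of_countable (binCenter (tau n α mt))).comp (measurable_electedBin (n / 2))
  exact ((measurable_averageEstimate.mul_const _).sub
    (Finset.measurable_fun_sum _ fun i _ => h1.const_mul _)).div_const _

lemma sq_dameEstimator_sub_le (hn : 2 ≤ n) (μ : Measure Obs) [IsProbabilityMeasure μ]
    (z : Fin n → Msg (numBins (tau n α mt))) (m : ℝ) :
    ((dameEstimator n α M mt z : ℝ) - mean μ) ^ 2 ≤
      mt / (sqrtMean M mt * (n / 2 : ℕ)) ^ 2 *
        ((n / 2 : ℕ) * (m - ∫ x, shrunkMean (tau n α mt) mt (electedBin (n / 2) z) x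
          ∂(dataLaw M μ)) + centredSum n m z) ^ 2 := by
  have hτ := tau_pos n α mt
  have hh : (0 : ℝ) < (n / 2 : ℕ) := by exact_mod_cast (by omega : 0 < n / 2)
  have h2 : (0 : ℝ) < mt := by exact_mod_cast mt.pos
  have he : 0 < sqrtMean M mt := zero_lt_one.trans_le (one_le_sqrtMean M)
  have hs : 0 < √(mt : ℝ) := Real.sqrt_pos.2 h2
  have hθ := abs_le.1 (abs_mean_le μ)
  have h1 : |(dameEstimator n α M mt z : ℝ) - mean μ| ≤
      |debiased (tau n α mt) M mt z - mean μ| := by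
    rw [dameEstimator, Set.coe_projIcc]
    exact abs_clamp_sub_le hθ.1 hθ.2
  rw [integral_shrunkMean M μ hτ (electedBin_lt (numBins_pos hτ) _ z)]
  set s := binCenter (tau n α mt) (electedBin (n / 2) z) with hse
  have h3 : debiased (tau n α mt) M mt z - mean μ = √(mt : ℝ) / (sqrtMean M mt * (n / 2 : ℕ)) *
      ((n / 2 : ℕ) * (m - (sqrtMean M mt / √(mt : ℝ) * mean μ +
        (1 - sqrtMean M mt / √(mt : ℝ)) * s)) + centredSum n m z) := by
    rw [centredSum, sum_ite_half, debiased, averageEstimate, ← hse, ← Finset.sum_mul,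
      sum_sqrt_sub]
    field_simp
    ring
  rw [← sq_abs]
  refine (pow_le_pow_left₀ (abs_nonneg _) h1 2).trans (le_of_eq ?_)
  rw [sq_abs, h3, mul_pow, div_pow, Real.sq_sqrt h2.le]

lemma sq_sub_le_four (n : ℕ) (α : ℝ) (mt : ℕ+) (μ : Measure Obs) [IsProbabilityMeasure μ]
    (z : Fin n → Msg (numBins (tau n α mt))) :
    ((dameEstimator n α M mt z : ℝ) - mean μ) ^ 2 ≤ 4 := by
  have h1 := (dameEstimator n α M mt z).2
  have h2 := abs_le.1 (abs_mean_le μ)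
  nlinarith [h1.1, h1.2, h2.1, h2.2]

lemma worstCaseRisk_le_four :
    worstCaseRisk M (dameWith c b n α mt) (dameEstimator n α M mt) ≤ ENNReal.ofReal 4 := by
  refine iSup_le fun μ => ?_
  have := (dameWith c b n α mt).isProbabilityMeasure_transcriptLaw (dataLaw M (μ : Measure Obs))
    n le_rfl
  refine (lintegral_mono fun z => ENNReal.ofReal_le_ofReal
    (sq_sub_le_four M n α mt (μ : Measure Obs) z)).trans ?_
  rw [lintegral_const, measure_univ, mul_one]

open Classical in
lemma worstCaseRisk_le (hc : 5 ≤ c) (hn : 2 ≤ n) (hα : 0 ≤ α)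
    (hs : 0 ≤ separation M mt α (tau n α mt)) :
    worstCaseRisk M (dameWith c b n α mt) (dameEstimator n α M mt) ≤
      ENNReal.ofReal (mt / sqrtMean M mt ^ 2 *
          ((2 * Real.exp (-(mt * tau n α mt ^ 2 / 2)) / (mt * tau n α mt)) ^ 2 +
            noiseLevel b α (tau n α mt) mt / (n / 2 : ℕ)) +
        4 * (((numBins (tau n α mt) : ℝ) - 1) *
          Real.exp (-((n / 2 : ℕ) * separation M mt α (tau n α mt) ^ 2 / 2)))) := by
  refine iSup_le fun P => ?_
  obtain ⟨μ, hμ⟩ := P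
  change ∫⁻ z, ENNReal.ofReal (((dameEstimator n α M mt z : ℝ) - mean μ) ^ 2)
    ∂((dameWith c b n α mt).transcriptLaw (dataLaw M μ) n le_rfl) ≤ _
  set τ := tau n α mt with hτe
  have hτ : 0 < τ := tau_pos n α mt
  have hJ : (1 : ℝ) ≤ numBins τ := by exact_mod_cast numBins_pos hτ
  have hh : (0 : ℝ) < (n / 2 : ℕ) := by exact_mod_cast (by omega : 0 < n / 2)
  have h2 : (0 : ℝ) < mt := by exact_mod_cast mt.pos
  have he : 0 < sqrtMean M mt := zero_lt_one.trans_le (one_le_sqrtMean M)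
  have hV := noiseLevel_nonneg b α τ mt
  set β := 2 * Real.exp (-(mt * τ ^ 2 / 2)) / (mt * τ) with hβ
  set C := mt / (sqrtMean M mt * (n / 2 : ℕ)) ^ 2 with hC
  have hC0 : 0 ≤ C := by positivity
  set m : ℕ → ℝ := fun j => ∫ x, userEstimate c τ mt j x ∂(dataLaw M μ) with hm
  set a₀ : ℕ → ℝ := fun j => (n / 2 : ℕ) * (m j - ∫ x, shrunkMean τ mt j x ∂(dataLaw M μ)) with ha
  have ha₀ : ∀ j, IsNear τ (mean μ) j → |a₀ j| ≤ (n / 2 : ℕ) * β := fun j hj => by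
    rw [ha, abs_mul, abs_of_pos hh]
    gcongr
    exact abs_integral_userEstimate_sub_le M μ hτ hc hj
  have hA := lintegral_centredSum_le (b := b) M μ hc a₀ _ ha₀ n (Nat.div_le_self n 2) le_rfl
  have hB := lintegral_not_isNear_le (c := c) (b := b) M μ hα hs n (Nat.div_le_self n 2) le_rfl
  have hpt : ∀ z : Fin n → Msg (numBins τ),
      ENNReal.ofReal (((dameEstimator n α M mt z : ℝ) - mean μ) ^ 2) ≤
        ENNReal.ofReal C * (if IsNear τ (mean μ) (electedBin (n / 2) z) then
          ENNReal.ofReal ((a₀ (electedBin (n / 2) z) +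
            centredSum n (m (electedBin (n / 2) z)) z) ^ 2) else 0) +
        ENNReal.ofReal 4 * (if IsNear τ (mean μ) (electedBin (n / 2) z) then 0 else 1) := fun z => by
    split_ifs with hz
    · rw [mul_zero, add_zero, ← ENNReal.ofReal_mul hC0]
      exact ENNReal.ofReal_le_ofReal (sq_dameEstimator_sub_le M hn μ z _)
    · rw [mul_zero, zero_add, mul_one]
      exact ENNReal.ofReal_le_ofReal (sq_sub_le_four M n α mt μ z)
  have hmeas : Measurable fun z : Fin n → Msg (numBins τ) => ENNReal.ofReal 4 *
      (if IsNear τ (mean μ) (electedBin (n / 2) z) then 0 else 1) :=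
    ((measurable_of_countable fun j => if IsNear τ (mean μ) j then (0 : ENNReal) else 1).comp
      (measurable_electedBin (n / 2))).const_mul _
  refine (lintegral_mono hpt).trans ?_
  rw [lintegral_add_right _ hmeas, lintegral_const_mul' _ _ ENNReal.ofReal_ne_top,
    lintegral_const_mul' _ _ ENNReal.ofReal_ne_top]
  refine (add_le_add (mul_le_mul_right hA _) (mul_le_mul_right hB _)).trans ?_
  have hcount : min n (2 * (n / 2)) - n / 2 = n / 2 := by omega
  rw [hcount, ← ENNReal.ofReal_mul hC0, ← ENNReal.ofReal_mul (by norm_num),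
    ← ENNReal.ofReal_add (by positivity)
      (mul_nonneg (by norm_num) (mul_nonneg (by linarith) (Real.exp_pos _).le))]
  refine ENNReal.ofReal_le_ofReal (le_of_eq ?_)
  congr 1
  rw [hC]
  field_simp

end risk

/-! ### Elementary estimates -/

lemma tailProb_nonneg (M : PMF ℕ+) (a : ℕ+) : 0 ≤ tailProb M a :=
  tsum_nonneg fun k => by
    split_ifs
    · exact ENNReal.toReal_nonneg
    · exact le_rfl

lemma tailProb_le_one (M : PMF ℕ+) (a : ℕ+) : tailProb M a ≤ 1 := by
  refine hasSum_le (fun k => ?_) (by simpa using hasSum_tailProb M a 1) (hasSum_toReal M)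
  split_ifs
  · exact le_rfl
  · exact ENNReal.toReal_nonneg

lemma mul_tailProb_le (M : PMF ℕ+) (hM : Summable fun k : ℕ+ => (k : ℝ) * (M k).toReal) (a : ℕ+) :
    a * tailProb M a ≤ ∑' k : ℕ+, (k : ℝ) * (M k).toReal := by
  rw [mul_comm]
  refine hasSum_le (fun k => ?_) (hasSum_tailProb M a a) hM.hasSum
  rw [mul_comm]
  refine mul_le_mul_of_nonneg_right ?_ ENNReal.toReal_nonneg
  split_ifs with h
  · exact_mod_cast h
  · positivity

lemma half_sqrt_le_div_log {y : ℝ} (hy : 8 ≤ y) : √y / 2 ≤ y / Real.log y := by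
  have hs : 0 < √y := Real.sqrt_pos.2 (by linarith)
  have e : y = √y ^ 2 := (Real.sq_sqrt (by linarith)).symm
  have hl : Real.log y ≤ 2 * √y := by
    conv_lhs => rw [e, Real.log_pow]
    have := Real.log_le_sub_one_of_pos hs
    push_cast
    linarith
  rw [le_div_iff₀ (Real.log_pos (by linarith))]
  nlinarith

lemma quarter_le_log_div_log {y : ℝ} (hy : 8 ≤ y) : 1 / 4 ≤ Real.log (y / Real.log y) := by
  have h1 := half_sqrt_le_div_log hy
  have h2 : 2.8 ≤ √y := Real.le_sqrt_of_sq_le (by linarith)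
  have h3 : 1.4 ≤ y / Real.log y := by linarith
  have h4 := Real.one_sub_inv_le_log_of_pos (by norm_num : (0 : ℝ) < 1.4)
  have h5 := Real.log_le_log (by norm_num) h3
  norm_num at h4
  linarith

lemma three_le_log_div_log {y : ℝ} (hy : 3000 ≤ y) : 3 ≤ Real.log (y / Real.log y) := by
  have h1 := half_sqrt_le_div_log (by linarith : 8 ≤ y)
  have h2 : 54 ≤ √y := Real.le_sqrt_of_sq_le (by linarith)
  rw [Real.le_log_iff_exp_le (by linarith)]
  have h3 : Real.exp 3 ≤ 2.7182818286 ^ 3 := by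
    rw [show (3 : ℝ) = (3 : ℕ) * 1 by norm_num, Real.exp_nat_mul]
    exact pow_le_pow_left₀ (Real.exp_pos _).le Real.exp_one_lt_d9.le 3
  norm_num at h3
  linarith

lemma le_rrFactor {α : ℝ} (hα : 0 < α) (hα' : α ≤ 22 / 35) :
    α ^ 2 / 144 * 0.9977 ≤ rrFactor α ^ 2 := by
  have h0 : α / 12 * (1 - (α / 6) ^ 2 / 10) ≤ rrFactor α := by
    set y := α / 6 with hy
    have hy0 : 0 < y := by positivity
    have hy1 : y ≤ 1 / 2 := by rw [hy]; linarith
    have he := Real.sum_le_exp_of_nonneg hy0.le 4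
    norm_num [Finset.sum_range_succ, Nat.factorial] at he
    have ht : α / 12 * (1 - y ^ 2 / 10) = y / 2 * (1 - y ^ 2 / 10) := by rw [hy]; ring
    rw [ht, rrFactor, le_div_iff₀ (by positivity)]
    have h1 : 0 ≤ 1 - y / 2 * (1 - y ^ 2 / 10) := by nlinarith
    have h2 := mul_le_mul_of_nonneg_right he h1
    have h3 : 0 ≤ y ^ 3 * (1 / 60 - y / 30 + y ^ 2 / 40 + y ^ 3 / 120) :=
      mul_nonneg (by positivity) (by nlinarith [pow_pos hy0 2, pow_pos hy0 3])
    nlinarith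
  have h1 : 0.99889 ≤ 1 - (α / 6) ^ 2 / 10 := by nlinarith
  have h2 : α / 12 * 0.99889 ≤ rrFactor α := le_trans (by gcongr) h0
  have h3 := pow_le_pow_left₀ (by positivity) h2 2
  nlinarith [sq_nonneg α]

section rates

variable {n : ℕ} {α : ℝ} {mt : ℕ+}

/-- `a n α² ∨ 1`. -/
def effSize (n : ℕ) (α : ℝ) (a : ℕ+) : ℝ := max (a * (n * α ^ 2)) 1

lemma one_le_effSize (n : ℕ) (α : ℝ) (a : ℕ+) : 1 ≤ effSize n α a := le_max_right _ _

lemma logTerm_eq (n : ℕ) (α : ℝ) (a : ℕ+) :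
    logTerm n α a = Real.log (8 * √(effSize n α a)) := by
  rw [effSize, Real.sqrt_monotone.map_max, Real.sqrt_one]
  rfl

lemma phi_eq (n : ℕ) (α : ℝ) (a : ℕ+) : phi n α a = 868.5 / (n * α ^ 2) *
    Real.log (8 * effSize n α a / Real.log (8 * effSize n α a)) := rfl

lemma exp_neg_logTerm (n : ℕ) (α : ℝ) (a : ℕ+) :
    Real.exp (-logTerm n α a) = 1 / (8 * √(effSize n α a)) := by
  have h := Real.sqrt_pos.2 (zero_lt_one.trans_le (one_le_effSize n α a))
  rw [logTerm_eq, Real.exp_neg, Real.exp_log (by positivity), one_div]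

lemma tau_sq (n : ℕ) (α : ℝ) (mt : ℕ+) : tau n α mt ^ 2 = 2 * logTerm n α mt / mt :=
  Real.sq_sqrt (by have := logTerm_pos n α mt; positivity)

lemma mul_tau_sq (n : ℕ) (α : ℝ) (mt : ℕ+) : mt * tau n α mt ^ 2 / 2 = logTerm n α mt := by
  have h2 : (0 : ℝ) < mt := by exact_mod_cast mt.pos
  rw [tau_sq]
  field_simp

lemma log_effSize_le (n : ℕ) (α : ℝ) (a : ℕ+) :
    Real.log (8 * effSize n α a) ≤ 2 * logTerm n α a := by
  have h0 := one_le_effSize n α a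
  rw [logTerm_eq, ← Nat.cast_ofNat (R := ℝ) (n := 2), ← Real.log_pow]
  refine Real.log_le_log (by linarith) ?_
  rw [mul_pow, Real.sq_sqrt (by linarith)]
  linarith

lemma separation_eq (M : PMF ℕ+) : separation M mt α (tau n α mt) =
    tailProb M mt * (1 - 1 / (2 * √(effSize n α mt))) * rrFactor α := by
  rw [separation, mul_tau_sq, exp_neg_logTerm]
  congr 2
  ring

lemma separation_nonneg (M : PMF ℕ+) (hα : 0 ≤ α) : 0 ≤ separation M mt α (tau n α mt) := by
  have h1 : 1 ≤ √(effSize n α mt) := Real.one_le_sqrt.2 (one_le_effSize n α mt)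
  rw [separation_eq]
  refine mul_nonneg (mul_nonneg (tailProb_nonneg M mt) (sub_nonneg.2 ?_)) (rrFactor_nonneg hα)
  rw [div_le_one (by linarith)]
  linarith

lemma exists_isGreatest (M : PMF ℕ+) (hM : Summable fun k : ℕ+ => (k : ℝ) * (M k).toReal)
    (hN : 0 < n * α ^ 2) :
    ∃ mt : ℕ+, IsGreatest {a : ℕ+ | a = 1 ∨ phi n α a ≤ tailProb M a ^ 2} mt := by
  set E := ∑' k : ℕ+, (k : ℝ) * (M k).toReal
  set q := √(868.5 / (n * α ^ 2) * (1 / 4)) with hq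
  have hq0 : 0 < q := Real.sqrt_pos.2 (by positivity)
  obtain ⟨B, hB⟩ := exists_nat_gt (E / q)
  have hfin : {a : ℕ+ | a = 1 ∨ phi n α a ≤ tailProb M a ^ 2}.Finite := by
    refine (Set.finite_Iic (B.succPNat)).subset fun a ha => ?_
    rcases ha with ha | ha
    · rw [ha]
      exact Set.mem_Iic.2 one_le
    · have h1 : q ≤ tailProb M a := by
        refine Real.sqrt_le_iff.2 ⟨tailProb_nonneg M a, le_trans ?_ ha⟩
        rw [phi_eq]
        gcongr
        exact quarter_le_log_div_log (by linarith [one_le_effSize n α a])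
      have h2 : (a : ℝ) * q ≤ E :=
        (mul_le_mul_of_nonneg_left h1 (by positivity)).trans (mul_tailProb_le M hM a)
      rw [← le_div_iff₀ hq0] at h2
      have h3 : (a : ℕ) < B := by exact_mod_cast h2.trans_lt hB
      exact (PNat.coe_le_coe _ _).1 (by rw [Nat.succPNat_coe]; omega)
  obtain ⟨mt, h1, h2⟩ := Set.exists_max_image _ id hfin ⟨1, Or.inl rfl⟩
  exact ⟨mt, h1, h2⟩

lemma phi_mul_le_one (M : PMF ℕ+) (hN : 0 < n * α ^ 2) (h : phi n α mt ≤ tailProb M mt ^ 2) :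
    868.5 * Real.log (8 * effSize n α mt / Real.log (8 * effSize n α mt)) ≤ n * α ^ 2 := by
  have h1 : tailProb M mt ^ 2 ≤ 1 := pow_le_one₀ (tailProb_nonneg M mt) (tailProb_le_one M mt)
  have h2 := h.trans h1
  rwa [phi_eq, div_mul_eq_mul_div, div_le_one hN] at h2

lemma two_le_of_ne_one {a : ℕ+} (h : a ≠ 1) : (2 : ℝ) ≤ a := by
  have h1 : (a : ℕ) ≠ 1 := fun h' => h (PNat.eq h')
  have h2 := a.pos
  exact_mod_cast (by omega : 2 ≤ (a : ℕ))

/-- In the nontrivial regime the sample is large. -/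
lemma eight_hundred_le (M : PMF ℕ+) (hN : 0 < n * α ^ 2)
    (hmt : mt = 1 ∨ phi n α mt ≤ tailProb M mt ^ 2) {K : ℝ} (hK : 1570 ≤ K)
    (h : K * logTerm n α mt / (n * α ^ 2 * sqrtMean M mt ^ 2) < 4) : 800 ≤ n * α ^ 2 := by
  have hL := logTerm_ge n α mt
  have hL8 := log_eight_gt
  by_cases h1 : mt = 1
  · have he : sqrtMean M mt = 1 := by
      refine le_antisymm ?_ (one_le_sqrtMean M)
      have := sqrtMean_le (mt := mt) M
      rw [h1] at this ⊢
      simpa using this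
    rw [he, one_pow, mul_one, div_lt_iff₀ hN] at h
    nlinarith
  · have h2 := phi_mul_le_one M hN (hmt.resolve_left h1)
    have h3 := quarter_le_log_div_log
      (by linarith [one_le_effSize n α mt] : 8 ≤ 8 * effSize n α mt)
    have h5 : 2 * (n * α ^ 2) ≤ effSize n α mt :=
      (mul_le_mul_of_nonneg_right (two_le_of_ne_one h1) hN.le).trans (le_max_left _ _)
    have h6 : 868.5 * (1 / 4) ≤ n * α ^ 2 := le_trans (by gcongr) h2
    have h7 := three_le_log_div_log (y := 8 * effSize n α mt) (by linarith)
    linarith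

/-- The exponent in the probability of electing a remote bin. -/
lemma le_exponent (M : PMF ℕ+) (hα : 0 < α) (hα' : α ≤ 22 / 35) (hN : 800 ≤ n * α ^ 2)
    (hmt : phi n α mt ≤ tailProb M mt ^ 2) :
    1.5 * Real.log (8 * effSize n α mt / Real.log (8 * effSize n α mt)) - 4 ≤
      (n / 2 : ℕ) * separation M mt α (tau n α mt) ^ 2 / 2 := by
  have hN0 : 0 < n * α ^ 2 := by linarith
  have hx := one_le_effSize n α mt
  have h1 := phi_mul_le_one M hN0 hmt
  rw [phi_eq] at hmt
  have hl0 := quarter_le_log_div_log (by linarith : 8 ≤ 8 * effSize n α mt)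
  have hl2 : 1 ≤ Real.log (8 * effSize n α mt) := by
    have := Real.log_le_log (by norm_num) (by linarith : 8 ≤ 8 * effSize n α mt)
    linarith [log_eight_gt]
  have hxN : n * α ^ 2 ≤ effSize n α mt := by
    refine le_trans ?_ (le_max_left _ _)
    exact le_mul_of_one_le_left hN0.le (by exact_mod_cast (one_le : 1 ≤ mt))
  have hn : 0 < (n : ℝ) := by
    by_contra hn
    nlinarith [sq_nonneg α]
  have hαsq : α ^ 2 ≤ 0.4 := by nlinarith
  have hS : 28 ≤ √(effSize n α mt) := Real.le_sqrt_of_sq_le (by linarith)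
  have hlS : Real.log (8 * effSize n α mt / Real.log (8 * effSize n α mt)) ≤
      2.1 * √(effSize n α mt) := by
    have h2 : Real.log (8 * effSize n α mt / Real.log (8 * effSize n α mt)) ≤
        Real.log (8 * effSize n α mt) :=
      Real.log_le_log (by positivity) (div_le_self (by linarith) hl2)
    have h3 := log_effSize_le n α mt
    rw [logTerm_eq, Real.log_mul (x := 8) (y := √(effSize n α mt)) (by norm_num)
      (by positivity)] at h3
    have h4 := Real.log_le_sub_one_of_pos (by linarith : 0 < √(effSize n α mt))
    have h5 : Real.log 8 < 2.08 := by
      rw [show (8 : ℝ) = 2 ^ 3 by norm_num, Real.log_pow]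
      have := Real.log_two_lt_d9
      push_cast
      linarith
    linarith
  set l := Real.log (8 * effSize n α mt / Real.log (8 * effSize n α mt)) with hl
  set S := √(effSize n α mt) with hSdef
  have hS0 : 0 < S := by linarith
  have hln : l ≤ 0.01 * n := by nlinarith
  have hsep : 6 * l / n * (1 - 1 / S) ≤ separation M mt α (tau n α mt) ^ 2 := by
    have h2 := mul_le_mul hmt (le_rrFactor hα hα') (by positivity) (sq_nonneg _)
    have h3 : 868.5 / (n * α ^ 2) * l * (α ^ 2 / 144 * 0.9977) =
        (868.5 * 0.9977 / 144) * (l / n) := by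
      field_simp
    have h4 : 6 * l / n ≤ tailProb M mt ^ 2 * rrFactor α ^ 2 := by
      have : 0 ≤ l / n := by positivity
      rw [mul_div_assoc]
      linarith
    have h5 : 1 - 1 / S ≤ (1 - 1 / (2 * S)) ^ 2 := by
      have : (1 - 1 / (2 * S)) ^ 2 = 1 - 1 / S + (1 / (2 * S)) ^ 2 := by
        field_simp
        ring
      rw [this]
      linarith [sq_nonneg (1 / (2 * S))]
    have h6 : 0 ≤ 1 - 1 / S := by
      rw [sub_nonneg, div_le_one hS0]
      linarith
    rw [separation_eq]
    calc _ ≤ tailProb M mt ^ 2 * rrFactor α ^ 2 * (1 - 1 / (2 * S)) ^ 2 :=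
          mul_le_mul h4 h5 h6 (by positivity)
      _ = _ := by ring
  have hh : ((n : ℝ) - 1) / 2 ≤ (n / 2 : ℕ) := by
    have : (n : ℝ) ≤ 2 * (n / 2 : ℕ) + 1 := by exact_mod_cast (by omega : n ≤ 2 * (n / 2) + 1)
    linarith
  have hfac : 0 ≤ 6 * l / n * (1 - 1 / S) := by
    refine mul_nonneg (by positivity) ?_
    rw [sub_nonneg, div_le_one hS0]
    linarith
  have hlow := mul_le_mul hh hsep hfac (Nat.cast_nonneg _)
  have e : ((n : ℝ) - 1) / 2 * (6 * l / n * (1 - 1 / S)) =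
      2 * (1.5 * l - 1.5 * (l / n) - 1.5 * (l / S) + 1.5 * (l / n / S)) := by
    field_simp
    ring
  have h7 : l / n ≤ 0.01 := by rwa [div_le_iff₀ hn]
  have h8 : l / S ≤ 2.1 := by rwa [div_le_iff₀ hS0]
  have h9 : 0 ≤ l / n / S := by positivity
  linarith

/-- The localisation phase contributes little to the risk. -/
lemma failure_le (M : PMF ℕ+) (hα : 0 < α) (hα' : α ≤ 22 / 35) (hN : 800 ≤ n * α ^ 2)
    (hmt : mt = 1 ∨ phi n α mt ≤ tailProb M mt ^ 2) :
    mt * (n * α ^ 2) * (4 * (((numBins (tau n α mt) : ℝ) - 1) *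
      Real.exp (-((n / 2 : ℕ) * separation M mt α (tau n α mt) ^ 2 / 2)))) ≤
      logTerm n α mt := by
  have hτ := tau_pos n α mt
  have hL := logTerm_ge n α mt
  have hL8 := log_eight_gt
  have hmt0 : (1 : ℝ) ≤ mt := by exact_mod_cast (one_le : 1 ≤ mt)
  by_cases h1 : mt = 1
  · have h2 : (1 : ℝ) ≤ tau n α mt := by
      refine (one_le_sq_iff₀ hτ.le).1 ?_
      rw [tau_sq, h1]
      rw [h1] at hL
      norm_num
      linarith
    have h3 : (numBins (tau n α mt) : ℝ) - 1 = 0 := by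
      have h4 : numBins (tau n α mt) ≤ 1 := by
        refine Nat.ceil_le.2 ?_
        rw [div_le_iff₀ hτ]
        simpa using h2
      have h5 : numBins (tau n α mt) = 1 := le_antisymm h4 (numBins_pos hτ)
      rw [h5]
      norm_num
    rw [h3]
    linarith
  · have hexp := le_exponent M hα hα' hN (hmt.resolve_left h1)
    have hx : effSize n α mt = mt * (n * α ^ 2) := max_eq_left (by nlinarith)
    have hx1 := one_le_effSize n α mt
    have hlog := log_effSize_le n α mt
    rw [← hx]
    set x := effSize n α mt with hxdef
    set L := logTerm n α mt with hLdef
    set B := 8 * x / Real.log (8 * x) with hB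
    have hlog0 : 0 < Real.log (8 * x) := Real.log_pos (by linarith)
    have hB0 : 0 < B := by positivity
    have hBi : B⁻¹ ≤ L / (4 * x) := by
      rw [hB, inv_div, div_le_div_iff₀ (by positivity) (by positivity)]
      nlinarith
    set E := Real.exp (-(1.5 * Real.log B)) with hE
    have hE2 : E ^ 2 ≤ (L / (4 * x)) ^ 3 := by
      have : E ^ 2 = B⁻¹ ^ 3 := by
        rw [hE, ← Real.exp_nat_mul, ← Real.exp_log (inv_pos.2 hB0), ← Real.exp_nat_mul,
          Real.log_inv]
        congr 1
        push_cast
        ring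
      rw [this]
      exact pow_le_pow_left₀ (by positivity) hBi 3
    have he4 : Real.exp 4 ≤ 55 := by
      have h3 : Real.exp 4 ≤ 2.7182818286 ^ 4 := by
        rw [show (4 : ℝ) = (4 : ℕ) * 1 by norm_num, Real.exp_nat_mul]
        exact pow_le_pow_left₀ (Real.exp_pos _).le Real.exp_one_lt_d9.le 4
      exact h3.trans (by norm_num)
    have hJ := numBins_sub_one_le hτ
    have hJ0 : (0 : ℝ) ≤ (numBins (tau n α mt) : ℝ) - 1 :=
      sub_nonneg.2 (by exact_mod_cast numBins_pos hτ)
    have hP : Real.exp (-((n / 2 : ℕ) * separation M mt α (tau n α mt) ^ 2 / 2)) ≤ 55 * E := by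
      calc _ ≤ Real.exp (4 + -(1.5 * Real.log B)) := Real.exp_le_exp.2 (by linarith)
        _ = Real.exp 4 * E := Real.exp_add _ _
        _ ≤ 55 * E := by gcongr
    have hL0 : 0 < L := by linarith
    calc _ ≤ x * (4 * (1 / tau n α mt * (55 * E))) := by gcongr
      _ ≤ L := by
        refine abs_le_of_sq_le_sq' ?_ hL0.le |>.2
        have e1 : (x * (4 * (1 / tau n α mt * (55 * E)))) ^ 2 =
            48400 * x ^ 2 * E ^ 2 / tau n α mt ^ 2 := by
          field_simp
          ring
        rw [e1, tau_sq, ← hLdef]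
        calc _ ≤ 48400 * x ^ 2 * (L / (4 * x)) ^ 3 / (2 * L / mt) := by gcongr
          _ = L ^ 2 * (3025 / (8 * (n * α ^ 2))) := by
            rw [hx]
            have : (mt : ℝ) ≠ 0 := by positivity
            have hnα : (n : ℝ) * α ^ 2 ≠ 0 := by linarith
            set N := (n : ℝ) * α ^ 2
            field_simp
            norm_num
          _ ≤ L ^ 2 * 1 := by
            gcongr
            rw [div_le_one (by linarith)]
            linarith
          _ = L ^ 2 := mul_one _

end rates

lemma mul_bias_sq_le {n : ℕ} {α : ℝ} {mt : ℕ+} (hN : 0 < n * α ^ 2) :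
    mt * (2 * Real.exp (-(mt * tau n α mt ^ 2 / 2)) / (mt * tau n α mt)) ^ 2 ≤
      0.01 * logTerm n α mt / (n * α ^ 2) := by
  have h2 : (0 : ℝ) < mt := by exact_mod_cast mt.pos
  have hmt1 : (1 : ℝ) ≤ mt := by exact_mod_cast (one_le : 1 ≤ mt)
  have hL : 2.07 < logTerm n α mt := log_eight_gt.trans_le (logTerm_ge n α mt)
  have hx := one_le_effSize n α mt
  have hxN : n * α ^ 2 ≤ effSize n α mt :=
    (le_mul_of_one_le_left hN.le hmt1).trans (le_max_left _ _)
  rw [mul_tau_sq, exp_neg_logTerm, div_pow, mul_pow, mul_pow, div_pow, mul_pow,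
    Real.sq_sqrt (by linarith), tau_sq]
  set L := logTerm n α mt
  set x := effSize n α mt
  have e : mt * (2 ^ 2 * (1 ^ 2 / (8 ^ 2 * x)) / (mt ^ 2 * (2 * L / mt))) = 1 / (32 * x * L) := by
    field_simp
    norm_num
  rw [e, div_le_div_iff₀ (by positivity) hN, one_mul]
  have h3 : (1 : ℝ) ≤ 0.01 * 32 * (L * L) := by nlinarith
  nlinarith

lemma mul_noiseLevel_div_le {b : ℝ} {n : ℕ} {α : ℝ} {mt : ℕ+} (hα : 0 < α) (hα' : α ≤ 22 / 35)
    (hN : 800 ≤ n * α ^ 2) :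
    mt * (noiseLevel b α (tau n α mt) mt / (n / 2 : ℕ)) ≤
      (52 + 8 * b ^ 2) / 0.9995 * logTerm n α mt / (n * α ^ 2) := by
  have h2 : (0 : ℝ) < mt := by exact_mod_cast mt.pos
  have hL : 2.07 < logTerm n α mt := log_eight_gt.trans_le (logTerm_ge n α mt)
  have hαsq : α ^ 2 ≤ 0.3952 := by nlinarith
  have hn : 2000 ≤ (n : ℝ) := by
    by_contra hn
    nlinarith [sq_nonneg α]
  have hh : 0.9995 * (n : ℝ) / 2 ≤ (n / 2 : ℕ) := by
    have : (n : ℝ) ≤ 2 * (n / 2 : ℕ) + 1 := by exact_mod_cast (by omega : n ≤ 2 * (n / 2) + 1)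
    linarith
  have hh0 : (0 : ℝ) < (n / 2 : ℕ) := by linarith
  have e : mt * (noiseLevel b α (tau n α mt) mt / (n / 2 : ℕ)) =
      (6.5 + 62.5 * logTerm n α mt + 4 * b ^ 2 * logTerm n α mt / α ^ 2) / (n / 2 : ℕ) := by
    rw [noiseLevel, div_pow, mul_pow, tau_sq]
    field_simp
    ring
  rw [e]
  set L := logTerm n α mt
  calc _ ≤ (6.5 + 62.5 * L + 4 * b ^ 2 * L / α ^ 2) / (0.9995 * n / 2) := by gcongr
    _ = (13 * α ^ 2 + 125 * α ^ 2 * L + 8 * b ^ 2 * L) / 0.9995 / (n * α ^ 2) := by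
        field_simp
        ring
    _ ≤ _ := by
        rw [div_mul_eq_mul_div]
        gcongr
        nlinarith

/-- The risk bound for DAME with margin `c` and noise level `b`. -/
lemma worstCaseRisk_dameWith_le {c b K : ℝ} {n : ℕ} {α : ℝ} {mt : ℕ+} (M : PMF ℕ+) (hc : 5 ≤ c)
    (hn : 1 ≤ n) (hα : 0 < α) (hα' : α ≤ 22 / 35)
    (hmt : mt = 1 ∨ phi n α mt ≤ tailProb M mt ^ 2) (hK : 1570 ≤ K)
    (hbK : (52 + 8 * b ^ 2) / 0.9995 + 1.01 ≤ K) :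
    worstCaseRisk M (dameWith c b n α mt) (dameEstimator n α M mt) ≤
      ENNReal.ofReal (min (K * logTerm n α mt / (n * α ^ 2 * sqrtMean M mt ^ 2)) 4) := by
  have hn0 : (0 : ℝ) < n := by exact_mod_cast hn
  have hN0 : 0 < n * α ^ 2 := by positivity
  rcases le_or_gt 4 (K * logTerm n α mt / (n * α ^ 2 * sqrtMean M mt ^ 2)) with h4 | h4
  · rw [min_eq_right h4]
    exact worstCaseRisk_le_four M
  · rw [min_eq_left h4.le]
    have hN := eight_hundred_le M hN0 hmt hK h4
    have hn2 : 2 ≤ n := by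
      by_contra h
      have : (n : ℝ) ≤ 1 := by exact_mod_cast (by omega : n ≤ 1)
      nlinarith
    refine (worstCaseRisk_le M hc hn2 hα.le (separation_nonneg M hα.le)).trans
      (ENNReal.ofReal_le_ofReal ?_)
    have he1 := one_le_sqrtMean (mt := mt) M
    have h2 : (0 : ℝ) < mt := by exact_mod_cast mt.pos
    have he2 : sqrtMean M mt ^ 2 ≤ mt := by
      rw [← Real.sq_sqrt h2.le]
      exact pow_le_pow_left₀ (by linarith) (sqrtMean_le M) 2
    have hL := logTerm_pos n α mt
    have hA := mul_bias_sq_le (mt := mt) hN0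
    have hB := mul_noiseLevel_div_le (b := b) (mt := mt) hα hα' hN
    have hC := failure_le M hα hα' hN hmt
    set β := (2 * Real.exp (-(mt * tau n α mt ^ 2 / 2)) / (mt * tau n α mt)) ^ 2
    set V := noiseLevel b α (tau n α mt) mt / (n / 2 : ℕ)
    set P := 4 * (((numBins (tau n α mt) : ℝ) - 1) *
      Real.exp (-((n / 2 : ℕ) * separation M mt α (tau n α mt) ^ 2 / 2)))
    set L := logTerm n α mt
    set e := sqrtMean M mt
    set N := n * α ^ 2
    have he0 : 0 < e := by linarith
    have hP : P ≤ L / (N * e ^ 2) := by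
      rw [le_div_iff₀ (by positivity)]
      have hJ0 : (0 : ℝ) ≤ (numBins (tau n α mt) : ℝ) - 1 :=
        sub_nonneg.2 (by exact_mod_cast numBins_pos (tau_pos n α mt))
      have hP0 : 0 ≤ P := by positivity
      nlinarith [mul_nonneg hP0 hN0.le]
    calc mt / e ^ 2 * (β + V) + P = (mt * β + mt * V) / e ^ 2 + P := by ring
      _ ≤ (0.01 * L / N + (52 + 8 * b ^ 2) / 0.9995 * L / N) / e ^ 2 + L / (N * e ^ 2) := by
          gcongr
      _ = ((52 + 8 * b ^ 2) / 0.9995 + 1.01) * L / (N * e ^ 2) := by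
          field_simp
          ring
      _ ≤ _ := by gcongr

end UserLDP

end

theorem theorem2 (n : ℕ) (hn : 1 ≤ n) (α : ℝ) (hα : 0 < α) (hα' : α ≤ 22 / 35)
    (M : PMF ℕ+) (hM : Summable fun k : ℕ+ => (k : ℝ) * (M k).toReal) :
    ∃ mt : ℕ+,
      IsGreatest {a : ℕ+ | a = 1 ∨ UserLDP.phi n α a ≤ UserLDP.tailProb M a ^ 2} mt ∧
      (UserLDP.dame n α mt).IsLDP α ∧
      Measurable (UserLDP.dameEstimator n α M mt) ∧
      UserLDP.worstCaseRisk M (UserLDP.dame n α mt) (UserLDP.dameEstimator n α M mt) ≤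
        ENNReal.ofReal (min
          (1650 * UserLDP.logTerm n α mt / (n * α ^ 2 * UserLDP.sqrtMean M mt ^ 2)) 4) ∧
      UserLDP.minimaxRisk α n M ≤
        ENNReal.ofReal (min
          (1570 * UserLDP.logTerm n α mt / (n * α ^ 2 * UserLDP.sqrtMean M mt ^ 2)) 4) := by
  have hn0 : (0 : ℝ) < n := by exact_mod_cast hn
  obtain ⟨mt, hmt⟩ := UserLDP.exists_isGreatest (n := n) (α := α) M hM (by positivity)
  refine ⟨mt, hmt, ?_, UserLDP.measurable_dameEstimator M, ?_, ?_⟩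
  · rw [UserLDP.dame_eq_dameWith]
    exact UserLDP.isLDP_dameWith (by norm_num) (by norm_num) n hα mt
  · rw [UserLDP.dame_eq_dameWith]
    exact UserLDP.worstCaseRisk_dameWith_le M (by norm_num) hn hα hα' hmt.1 (by norm_num)
      (by norm_num)
  · refine le_trans ?_ (UserLDP.worstCaseRisk_dameWith_le (c := 5) (b := 12) M le_rfl hn hα hα'
      hmt.1 le_rfl (by norm_num))
    exact iInf_le_of_le _ <| iInf_le_of_le _ <|
      iInf_le_of_le (UserLDP.dameWith 5 12 n α mt) <|
      iInf_le_of_le (UserLDP.isLDP_dameWith (by norm_num) (by norm_num) n hα mt) <|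
      iInf_le_of_le (UserLDP.dameEstimator n α M mt) <|
      iInf_le_of_le (UserLDP.measurable_dameEstimator M) le_rfl
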